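/- Let $p$ be a prime; all rings are commutative Noetherian of characteristic $p$, and $q=p^e$ with $e\ge 1$ denotes a varying power of $p$. **Definitions.** For a reduced ring $R$, $R^{1/q}\supseteq R$ is the ring of $q$-th roots of elements of $R$; $R$ is *$F$-finite* if $R^{1/p}$ is a finite $R$-module. For $c\in R$, "$Rc^{1/q}\subseteq R^{1/q}$ splits" means that there is an $R$-linear retraction of $R^{1/q}$ onto its submodule $Rc^{1/q}$. For an ideal $I$ of a ring $A$, $I^{[q]}$ is the ideal generated by the $q$-th powers of elements of $I$. The ideal $I$ is *Frobenius closed* if $x^q\in I^{[q]}$ for some $q$ implies $x\in I$; it is *tightly closed* if $x\in I$ whenever there is $c\in A$ outside every minimal prime of $A$ with $cx^q\in I^{[q]}$ for all $q\gg0$. A local ring $A$ is *$F$-injective* (resp. *$F$-rational*) if every ideal generated by a (possibly empty) part of a system of parameters is Frobenius closed (resp. tightly closed). A local ring $(A,\mathfrak m_A)$ is *Gorenstein* if some system of parameters $z_1,\dots,z_d$ of $A$ is a regular sequence with $\dim_{A/\mathfrak m_A}\bigl(0:_{A/(z_1,\dots,z_d)}\mathfrak m_A\bigr)=1$. For a module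 $M$ over a reduced ring $R$, *$0$ is Frobenius closed in $M$* if for every $q$ the map $M\to R^{1/q}\otimes_R M$, $u\mapsto 1\otimes u$, is injective. **Proposition 3.3.** Let $(R,\mathfrak m,K)\to(S,\mathfrak n,L)$ be a flat local homomorphism of $F$-finite reduced Noetherian local rings of characteristic $p$ such that the closed fiber $S/\mathfrak mS$ is Gorenstein. 1. Let $c\in R$. If $Rc^{1/q}\subseteq R^{1/q}$ splits over $R$ for some $q$, and $S/\mathfrak mS$ is $F$-injective, then $Sc^{1/q}\subseteq S^{1/q}$ splits over $S$ for some $q$. 2. Let $E_R(K)$ be an injective hull of $K$ over $R$. If $0$ is Frobenius closed in $E_R(K)$, $S/\mathfrak mS$ is $F$-rational, and $c\in S\setminus\mathfrak mS$, then $Sc^{1/q}\subseteq S^{1/q}$ splits over $S$ for some $q$. -/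

import Mathlib

open IsLocalRing

universe u v w

noncomputable section

namespace FSplit

/-! ### The ring of `q`-th roots -/

/-- `R^{1/q}` for `q = p ^ e`. For a reduced ring `R` of characteristic `p`, every element of
`R^{1/q}` is `x^{1/q}` for exactly one `x : R`, and `x ↦ x^{1/q}` is a ring isomorphism
`R ≃ R^{1/q}` (`qthRoot` below). So `R^{1/q}` is a copy of the ring `R`, and the inclusion
`R ⊆ R^{1/q}` is `r = (r ^ q)^{1/q}`, i.e. the `e`-th iterate of Frobenius. -/
@[nolint unusedArguments]
def RootRing (R : Type u) [CommRing R] (_p _e : ℕ) : Type u := R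

instance (R : Type u) [CommRing R] (p e : ℕ) : CommRing (RootRing R p e) :=
  inferInstanceAs (CommRing R)

/-- The isomorphism `x ↦ x^{1/q}` from `R` to `R^{1/q}`, `q = p ^ e`. -/
def qthRoot {R : Type u} [CommRing R] (p e : ℕ) : R ≃+* RootRing R p e := RingEquiv.refl R

/-- The inclusion `R ⊆ R^{1/q}`, `r ↦ (r ^ q)^{1/q}`, as an `R`-algebra structure. -/
instance (R : Type u) [CommRing R] (p e : ℕ) [Fact p.Prime] [CharP R p] :
    Algebra R (RootRing R p e) :=
  ((qthRoot p e : R ≃+* RootRing R p e).toRingHom.comp (iterateFrobenius R p e)).toAlgebra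

theorem algebraMap_rootRing {R : Type u} [CommRing R] (p e : ℕ) [Fact p.Prime] [CharP R p]
    (r : R) : algebraMap R (RootRing R p e) r = qthRoot p e (r ^ p ^ e) := rfl

/-- `(c^{1/q}) ^ q = c`. -/
theorem qthRoot_pow {R : Type u} [CommRing R] (p e : ℕ) [Fact p.Prime] [CharP R p] (c : R) :
    (qthRoot p e c) ^ p ^ e = algebraMap R (RootRing R p e) c := by
  rw [algebraMap_rootRing, map_pow]

/-- `R → R^{1/q}` is injective when `R` is reduced. -/
theorem algebraMap_rootRing_injective {R : Type u} [CommRing R] [IsReduced R] (p e : ℕ)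
    [Fact p.Prime] [CharP R p] : Function.Injective (algebraMap R (RootRing R p e)) := by
  intro a b h
  rw [algebraMap_rootRing, algebraMap_rootRing] at h
  exact iterateFrobenius_inj R p e ((qthRoot p e).injective h)

/-- `R` is `F`-finite: `R^{1/p}` is a finite `R`-module. -/
def FFinite (p : ℕ) (R : Type u) [CommRing R] [Fact p.Prime] [CharP R p] : Prop :=
  Module.Finite R (RootRing R p 1)

/-- The inclusion of `R`-modules `R c^{1/q} ⊆ R^{1/q}`, `q = p ^ e`, splits over `R`: there is
an `R`-linear retraction of `R^{1/q}` onto its submodule `R c^{1/q}`. -/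
def RootSplits (p e : ℕ) {R : Type u} [CommRing R] [Fact p.Prime] [CharP R p] (c : R) : Prop :=
  ∃ ρ : RootRing R p e →ₗ[R] Submodule.span R {(qthRoot p e c : RootRing R p e)},
    ∀ x : Submodule.span R {(qthRoot p e c : RootRing R p e)}, ρ x = x

/-! ### Frobenius closure and tight closure of ideals -/

/-- The Frobenius power `I^{[q]} = (i ^ q : i ∈ I)`. -/
def frobPower {A : Type u} [CommRing A] (I : Ideal A) (q : ℕ) : Ideal A :=
  Ideal.span ((fun i => i ^ q) '' (I : Set A))

/-- `I` is Frobenius closed: `x ^ q ∈ I^{[q]}` for some `q = p ^ e` implies `x ∈ I`. -/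
def IsFrobClosed (p : ℕ) {A : Type u} [CommRing A] (I : Ideal A) : Prop :=
  ∀ (x : A) (e : ℕ), x ^ p ^ e ∈ frobPower I (p ^ e) → x ∈ I

/-- `x` lies in the tight closure of `I`: there is `c` outside all minimal primes of `A` with
`c * x ^ q ∈ I^{[q]}` for all `q = p ^ e ≫ 0`. -/
def InTightClosure (p : ℕ) {A : Type u} [CommRing A] (I : Ideal A) (x : A) : Prop :=
  ∃ c : A, (∀ P ∈ minimalPrimes A, c ∉ P) ∧
    ∃ N : ℕ, ∀ e ≥ N, c * x ^ p ^ e ∈ frobPower I (p ^ e)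

/-- `I` is tightly closed. -/
def IsTightlyClosed (p : ℕ) {A : Type u} [CommRing A] (I : Ideal A) : Prop :=
  ∀ x : A, InTightClosure p I x → x ∈ I

/-! ### Parameters in a (Noetherian) local ring -/

/-- `z` is a system of parameters of the local ring `A`: it has `dim A` members and generates an
ideal primary to the maximal ideal. -/
def IsSOP {A : Type u} [CommRing A] [IsLocalRing A] (z : List A) : Prop :=
  (z.length : WithBot ℕ∞) = ringKrullDim A ∧ (Ideal.ofList z).radical = maximalIdeal A

/-- A parameter ideal: one generated by a (possibly empty) part of a system of parameters. -/
def IsParameterIdeal {A : Type u} [CommRing A] [IsLocalRing A] (I : Ideal A) : Prop :=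
  ∃ y y' : List A, IsSOP (y ++ y') ∧ I = Ideal.ofList y

/-- `A` is `F`-rational: every parameter ideal is tightly closed. -/
def FRational (p : ℕ) (A : Type u) [CommRing A] [IsLocalRing A] : Prop :=
  ∀ I : Ideal A, IsParameterIdeal I → IsTightlyClosed p I

/-- `A` is `F`-injective: every parameter ideal is Frobenius closed. -/
def FInjective (p : ℕ) (A : Type u) [CommRing A] [IsLocalRing A] : Prop :=
  ∀ I : Ideal A, IsParameterIdeal I → IsFrobClosed p I

/-- The socle `(0 :_{A/I} m)` of `A/I`, for `(A, m)` local. -/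
abbrev socle {A : Type u} [CommRing A] [IsLocalRing A] (I : Ideal A) : Submodule A (A ⧸ I) :=
  Submodule.torsionBySet A (A ⧸ I) (maximalIdeal A)

/-- A Noetherian local ring `(A, m)` is Gorenstein when it is Cohen-Macaulay of type one: some
system of parameters `z` is a regular sequence (Cohen-Macaulay), and the socle of `A/(z)` is
one-dimensional over `A/m`. -/
def IsGorensteinLocal (A : Type u) [CommRing A] [IsLocalRing A] : Prop :=
  IsNoetherianRing A ∧ ∃ z : List A, IsSOP z ∧ RingTheory.Sequence.IsRegular A z ∧
    Module.finrank (A ⧸ maximalIdeal A) (socle (Ideal.ofList z)) = 1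

/-! ### Injective hulls and Frobenius closure in a module -/

/-- `E` is an injective hull of the `R`-module `M`: an injective module which is an essential
extension of `M`. -/
def IsInjectiveHull (R : Type u) [CommRing R] (M : Type v) [AddCommGroup M] [Module R M]
    (E : Type u) [AddCommGroup E] [Module R E] : Prop :=
  Module.Injective R E ∧ ∃ i : M →ₗ[R] E, Function.Injective i ∧
    ∀ N : Submodule R E, N ≠ ⊥ → N ⊓ LinearMap.range i ≠ ⊥

open scoped TensorProduct in
/-- `0` is Frobenius closed in the `R`-module `M`: if the `q`-th power `1 ⊗ u` of `u : M` in
`F^e(M) = R^{1/q} ⊗_R M` vanishes for some `q = p ^ e`, then `u = 0`. -/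
def ZeroFrobClosed (p : ℕ) (R : Type u) [CommRing R] [Fact p.Prime] [CharP R p]
    (M : Type w) [AddCommGroup M] [Module R M] : Prop :=
  ∀ (e : ℕ) (u : M), (1 : RootRing R p e) ⊗ₜ[R] u = 0 → u = 0

/-! ### The closed fiber -/

/-- The closed fiber `S/mS` of a homomorphism `(R, m) → S`. -/
abbrev ClosedFiber (R : Type u) (S : Type v) [CommRing R] [IsLocalRing R] [CommRing S]
    [Algebra R S] : Type v :=
  S ⧸ (maximalIdeal R).map (algebraMap R S)

instance (R : Type u) (S : Type v) [CommRing R] [IsLocalRing R] [CommRing S] [IsLocalRing S]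
    [Algebra R S] [IsLocalHom (algebraMap R S)] : IsLocalRing (ClosedFiber R S) :=
  have hloc : IsLocalHom (algebraMap R S) := inferInstance
  have hle : (maximalIdeal R).map (algebraMap R S) ≤ maximalIdeal S :=
    ((IsLocalRing.local_hom_TFAE (algebraMap R S)).out 0 2).mp hloc
  have : Nontrivial (ClosedFiber R S) := Ideal.Quotient.nontrivial_iff.mpr fun h =>
    (maximalIdeal.isMaximal S).ne_top (top_le_iff.mp (h ▸ hle))
  IsLocalRing.of_surjective' (Ideal.Quotient.mk _) Ideal.Quotient.mk_surjective

end FSplit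

end

namespace FSplit

/-! Both parts are cases of one criterion, `rootSplits_algebraMap_mul`: the element d c with d in R
and c in S, where d carries the information over R and c is tested on the closed fiber.

A map A/J → N sending 1 to x, with N finite, has a retraction as soon as x ⊗ - is injective on
enough modules W: one for each power of the maximal ideal, each a cogenerator for the finite modules
over a finite length quotient of A approximating A/J (`exists_hom_apply_eq_one`). Cogenerators are
recognized numerically: W has simple socle, is killed by I, and is at least as long as A/I. Since
the socle is simple, x ⊗ - is injective on W once x ⊗ (socle generator) is nonzero.

Over S such modules come from R. Lift to S a system of parameters z of the closed fiber and a
generator v of its socle modulo z. Powers of z stay regular on the closed fiber, so with 𝔟 =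
(z^(k+1)) the ring S/𝔟 is flat over R. If ω is the annihilator of J + m^(k+1) in an injective
R-module E with simple socle generated by u, then W = S/𝔟 ⊗ ω has simple socle generated by v (∏
z)^k ⊗ u (`IsSocleGenerator.mk_tmul`, `GeneratesSocleMod.mul_prod`), and its length is controlled by
flatness.

To see that (dc)^(1/q) ⊗ (socle generator) is nonzero, map S^(1/q) ⊗ W to a quotient of S^(1/q),
flat over R^(1/q), tensored with R^(1/q) ⊗ ω. The image survives if d^(1/q) ⊗ u ≠ 0 and c v^q ∉ mS +
(z^q); the factor (∏ z)^(kq) is removed by a colon computation, so one q serves every k. In part 1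
the element of R splits and F-injectivity keeps v^q out of (z)^[q]. In part 2, d = 1 and Frobenius
closedness of 0 in E handles R, while F-rationality provides q with c v^q ∉ (z)^[q]; here c is an
admissible multiplier because an F-rational local ring is a domain. -/

/-- The list `z` is a (weakly) regular sequence modulo the ideal `I`. -/
def RegularMod {A : Type u} [CommRing A] : Ideal A → List A → Prop
  | _, [] => True
  | I, a :: l => (∀ x, a * x ∈ I → x ∈ I) ∧ RegularMod (I ⊔ Ideal.span {a}) l

/-- The list of `t`-th powers of the members of `z`. -/
abbrev powList {A : Type u} [CommRing A] (t : ℕ) (z : List A) : List A := z.map (· ^ t)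

/-! ### Regular sequences, their powers and colon ideals. -/

section RegularMod

variable {A : Type u} [CommRing A]

theorem mem_sup_span_singleton {I : Ideal A} {a x : A} :
    x ∈ I ⊔ Ideal.span {a} ↔ ∃ i ∈ I, ∃ y, x = i + a * y := by
  rw [Submodule.mem_sup]
  constructor
  · rintro ⟨i, hi, y, hy, rfl⟩
    obtain ⟨r, rfl⟩ := Ideal.mem_span_singleton'.mp hy
    exact ⟨i, hi, r, by ring⟩
  · rintro ⟨i, hi, y, rfl⟩
    exact ⟨i, hi, a * y, Ideal.mem_span_singleton'.mpr ⟨y, by ring⟩, rfl⟩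

/-- The half of permutability that needs no local or Noetherian hypothesis: the first element stays
regular after the second is killed. -/
theorem regular_sup_of_regular {I : Ideal A} {a b : A} (ha : ∀ x, a * x ∈ I → x ∈ I)
    (hb : ∀ x, b * x ∈ I ⊔ Ideal.span {a} → x ∈ I ⊔ Ideal.span {a}) :
    ∀ x, a * x ∈ I ⊔ Ideal.span {b} → x ∈ I ⊔ Ideal.span {b} := by
  intro x hx
  obtain ⟨i, hi, y, hy⟩ := mem_sup_span_singleton.mp hx
  obtain ⟨j, hj, y', rfl⟩ := mem_sup_span_singleton.mp
    (hb y (mem_sup_span_singleton.mpr ⟨-i, I.neg_mem hi, x, by rw [hy]; ring⟩))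
  refine mem_sup_span_singleton.mpr ⟨x - b * y', ha _ ?_, y', by ring⟩
  have : a * (x - b * y') = i + b * j := by rw [mul_sub, hy]; ring
  rw [this]
  exact I.add_mem hi (I.mul_mem_left _ hj)

theorem regular_sup_ofList {l : List A} {I : Ideal A} {a : A} (ha : ∀ x, a * x ∈ I → x ∈ I)
    (hl : RegularMod (I ⊔ Ideal.span {a}) l) :
    ∀ x, a * x ∈ I ⊔ Ideal.ofList l → x ∈ I ⊔ Ideal.ofList l := by
  induction l generalizing I with
  | nil => simpa using ha
  | cons b l ih =>
    rw [Ideal.ofList_cons, ← sup_assoc]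
    refine ih (regular_sup_of_regular ha hl.1) ?_
    rw [sup_right_comm]
    exact hl.2

/-- Induction along the filtration by powers of a: regularity modulo a gives x = j + a x', and
cancelling a leaves the same problem for x' with exponent one lower. -/
theorem regular_sup_pow {I : Ideal A} {a b : A} (ha : ∀ x, a * x ∈ I → x ∈ I)
    (hb : ∀ x, b * x ∈ I ⊔ Ideal.span {a} → x ∈ I ⊔ Ideal.span {a}) (t : ℕ) :
    ∀ x, b * x ∈ I ⊔ Ideal.span {a ^ t} → x ∈ I ⊔ Ideal.span {a ^ t} := by
  induction t with
  | zero => intro x _; simp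
  | succ t ih =>
    intro x hx
    obtain ⟨i, hi, y, hy⟩ := mem_sup_span_singleton.mp hx
    obtain ⟨j, hj, x', rfl⟩ := mem_sup_span_singleton.mp
      (hb x (mem_sup_span_singleton.mpr ⟨i, hi, a ^ t * y, by rw [hy]; ring⟩))
    have h : a * (b * x' - a ^ t * y) ∈ I := by
      have : a * (b * x' - a ^ t * y) = i - b * j := by linear_combination hy
      rw [this]
      exact I.sub_mem hi (I.mul_mem_left _ hj)
    obtain ⟨k, hk, y', rfl⟩ := mem_sup_span_singleton.mp
      (ih x' (mem_sup_span_singleton.mpr ⟨_, ha _ h, y, by ring⟩))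
    exact mem_sup_span_singleton.mpr
      ⟨j + a * k, I.add_mem hj (I.mul_mem_left _ hk), y', by ring⟩

theorem RegularMod.sup_pow {l : List A} {I : Ideal A} {a : A} (ha : ∀ x, a * x ∈ I → x ∈ I)
    (hl : RegularMod (I ⊔ Ideal.span {a}) l) (t : ℕ) :
    RegularMod (I ⊔ Ideal.span {a ^ t}) l := by
  induction l generalizing I with
  | nil => trivial
  | cons b l ih =>
    refine ⟨regular_sup_pow ha hl.1 t, ?_⟩
    rw [sup_right_comm]
    refine ih (regular_sup_of_regular ha hl.1) ?_
    rw [sup_right_comm]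
    exact hl.2

theorem regular_pow {I : Ideal A} {a : A} (ha : ∀ x, a * x ∈ I → x ∈ I) (t : ℕ) :
    ∀ x, a ^ t * x ∈ I → x ∈ I := by
  induction t with
  | zero => simp
  | succ t ih => intro x hx; exact ih x (ha _ (by rwa [pow_succ', mul_assoc] at hx))

theorem RegularMod.powList {l : List A} {I : Ideal A} (hl : RegularMod I l) (t : ℕ) :
    RegularMod I (powList t l) := by
  induction l generalizing I with
  | nil => trivial
  | cons a l ih => exact ⟨regular_pow hl.1 t, ih (hl.2.sup_pow hl.1 t)⟩

/-- Peel off one element at a time: induction handles the tail modulo a^(t+1), and a^t is then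
cancelled because a is regular modulo the tail. -/
theorem RegularMod.mem_of_mul_prod_mem {l : List A} {I : Ideal A} (hl : RegularMod I l) (t : ℕ)
    {x : A} (hx : x * (FSplit.powList t l).prod ∈ I ⊔ Ideal.ofList (FSplit.powList (t + 1) l)) :
    x ∈ I ⊔ Ideal.ofList l := by
  induction l generalizing I x with
  | nil => simpa using hx
  | cons a l ih =>
    have h := ih (hl.2.sup_pow hl.1 (t + 1)) (x := x * a ^ t) (by
      simpa [sup_assoc, mul_assoc, Ideal.ofList_cons] using hx)
    rw [sup_right_comm] at h
    obtain ⟨j, hj, y, hy⟩ := mem_sup_span_singleton.mp h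
    have h' := regular_pow (regular_sup_ofList hl.1 hl.2) t (x - a * y) (by
      have : a ^ t * (x - a * y) = j := by linear_combination hy
      rwa [this])
    rw [Ideal.ofList_cons, ← sup_assoc, sup_right_comm]
    exact mem_sup_span_singleton.mpr ⟨_, h', y, by ring⟩

theorem mul_prod_powList_mem (l : List A) (t : ℕ) {x : A} (hx : x ∈ Ideal.ofList l) :
    x * (powList t l).prod ∈ Ideal.ofList (powList (t + 1) l) := by
  induction l generalizing x with
  | nil => simpa using hx
  | cons a l ih =>
    rw [Ideal.ofList_cons] at hx
    obtain ⟨y, hy, r, hr, rfl⟩ := Submodule.mem_sup.mp hx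
    obtain ⟨s, rfl⟩ := Ideal.mem_span_singleton'.mp hy
    simp only [List.map_cons, List.prod_cons, Ideal.ofList_cons]
    rw [add_mul]
    refine Ideal.add_mem _ (Ideal.mem_sup_left ?_) (Ideal.mem_sup_right ?_)
    · exact Ideal.mem_span_singleton'.mpr ⟨s * (powList t l).prod, by ring⟩
    · rw [mul_left_comm]
      exact Ideal.mul_mem_left _ _ (ih hr)

theorem mul_prod_powList_mem_sup {l : List A} {I : Ideal A} (t : ℕ) {x : A}
    (hx : x ∈ I ⊔ Ideal.ofList l) :
    x * (powList t l).prod ∈ I ⊔ Ideal.ofList (powList (t + 1) l) := by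
  obtain ⟨y, hy, r, hr, rfl⟩ := Submodule.mem_sup.mp hx
  rw [add_mul]
  exact Ideal.add_mem _ (Ideal.mem_sup_left (Ideal.mul_mem_right _ _ hy))
    (Ideal.mem_sup_right (mul_prod_powList_mem l t hr))

/-- Socle elements modulo the powers of a regular sequence are multiples of the product of the
next lower powers. -/
theorem RegularMod.exists_mul_prod_of_socle {l : List A} {I n : Ideal A} (hl : RegularMod I l)
    (hn : ∀ a ∈ l, a ∈ n) (t : ℕ) {s : A}
    (hs : ∀ a ∈ n, a * s ∈ I ⊔ Ideal.ofList (FSplit.powList (t + 1) l)) :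
    ∃ s', s - s' * (FSplit.powList t l).prod ∈
      I ⊔ Ideal.ofList (FSplit.powList (t + 1) l) := by
  induction l generalizing I s with
  | nil => exact ⟨s, by simp⟩
  | cons a l ih =>
    have hl' := hl.2.sup_pow hl.1 (t + 1)
    have key : I ⊔ Ideal.ofList (FSplit.powList (t + 1) (a :: l)) =
      I ⊔ Ideal.span {a ^ (t + 1)} ⊔ Ideal.ofList (FSplit.powList (t + 1) l) := by
      simp [Ideal.ofList_cons, sup_assoc]
    rw [key] at hs ⊢
    obtain ⟨s1, hs1⟩ := ih hl' (fun b hb => hn b (List.mem_cons_of_mem _ hb)) hs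
    have h : a * s1 ∈ I ⊔ Ideal.span {a ^ (t + 1)} ⊔ Ideal.ofList l := by
      refine hl'.mem_of_mul_prod_mem t ?_
      have h1 := hs a (hn a List.mem_cons_self)
      have : a * s1 * (FSplit.powList t l).prod =
        a * s - a * (s - s1 * (FSplit.powList t l).prod) := by ring
      rw [this]
      exact Ideal.sub_mem _ h1 (Ideal.mul_mem_left _ _ hs1)
    rw [sup_right_comm] at h
    -- Here a s1 = j + a^(t+1) y with j in I + (l), and a is regular modulo that ideal, so s1 agrees
    -- with a^t y there.
    obtain ⟨j, hj, y, hy⟩ := mem_sup_span_singleton.mp h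
    have h' : s1 - a ^ t * y ∈ I ⊔ Ideal.ofList l :=
      regular_sup_ofList hl.1 hl.2 _ (by
        have : a * (s1 - a ^ t * y) = j := by linear_combination hy
        rwa [this])
    refine ⟨y, ?_⟩
    have : s - y * (FSplit.powList t (a :: l)).prod =
      (s - s1 * (FSplit.powList t l).prod) + (s1 - a ^ t * y) * (FSplit.powList t l).prod := by
      simp only [List.map_cons, List.prod_cons]; ring
    rw [this]
    refine Ideal.add_mem _ hs1 ?_
    have hle : I ⊔ Ideal.ofList (FSplit.powList (t + 1) l) ≤ I ⊔ Ideal.span {a ^ (t + 1)} ⊔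
      Ideal.ofList (FSplit.powList (t + 1) l) := sup_le_sup_right le_sup_left _
    exact hle (mul_prod_powList_mem_sup t h')

theorem regularMod_of_forall_take {l : List A} {I : Ideal A}
    (h : ∀ (i : ℕ) (hi : i < l.length) (x : A),
      l[i] * x ∈ I ⊔ Ideal.ofList (l.take i) → x ∈ I ⊔ Ideal.ofList (l.take i)) :
    RegularMod I l := by
  induction l generalizing I with
  | nil => trivial
  | cons a l ih =>
    refine ⟨fun x hx => by simpa using h 0 (by simp) x (by simpa using hx), ih fun i hi x hx => ?_⟩
    have := h (i + 1) (by simpa using hi) x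
    simp only [List.getElem_cons_succ, List.take_succ_cons, Ideal.ofList_cons, ← sup_assoc] at this
    exact this hx

theorem regularMod_of_isWeaklyRegular {l : List A}
    (h : RingTheory.Sequence.IsWeaklyRegular A l) : RegularMod ⊥ l := by
  refine regularMod_of_forall_take fun i hi x hx => ?_
  have hreg := h.regular_mod_prev i hi
  have h0 := mem_of_isSMulRegular_quotient_of_smul_mem hreg (x := x)
    (by simpa [smul_eq_mul] using hx)
  simpa [smul_eq_mul] using h0

theorem RegularMod.comap_mk {K : Ideal A} {l : List A} {J : Ideal (A ⧸ K)}
    (h : RegularMod J (l.map (Ideal.Quotient.mk K))) :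
    RegularMod (J.comap (Ideal.Quotient.mk K)) l := by
  induction l generalizing J with
  | nil => trivial
  | cons a l ih =>
    refine ⟨fun x hx => h.1 _ (by simpa using hx), ?_⟩
    have := ih h.2
    convert this using 1
    ext x
    rw [Ideal.mem_comap, mem_sup_span_singleton, mem_sup_span_singleton]
    constructor
    · rintro ⟨i, hi, y, rfl⟩
      exact ⟨_, hi, Ideal.Quotient.mk K y, by simp⟩
    · rintro ⟨i, hi, y, hy⟩
      obtain ⟨y, rfl⟩ := Ideal.Quotient.mk_surjective y
      refine ⟨x - a * y, ?_, y, by ring⟩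
      rw [Ideal.mem_comap, map_sub, hy, map_mul]
      simpa using hi

end RegularMod

/-! ### Matlis duality for finite length modules, by counting lengths. -/

section Duality

variable {A : Type u} [CommRing A]

theorem length_le_add_of_exact {M N P : Type*} [AddCommGroup M] [Module A M] [AddCommGroup N]
    [Module A N] [AddCommGroup P] [Module A P] (f : N →ₗ[A] M) (g : M →ₗ[A] P)
    (h : ∀ x, g x = 0 → ∃ y, f y = x) :
    Module.length A M ≤ Module.length A N + Module.length A P := by
  rw [Module.length_eq_add_of_exact (LinearMap.ker g).subtype g.rangeRestrict
    (LinearMap.ker g).injective_subtype g.surjective_rangeRestrict (by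
      intro x
      simp [Subtype.ext_iff])]
  refine add_le_add ?_ (Module.length_le_of_injective _ (LinearMap.range g).injective_subtype)
  have hle : LinearMap.ker g ≤ LinearMap.range f := fun x hx => h x hx
  exact (Module.length_le_of_injective _ (Submodule.inclusion_injective hle)).trans
    (Module.length_le_of_surjective _ f.surjective_rangeRestrict)

theorem length_hom_le_add {W M : Type*} [AddCommGroup W] [Module A W] [AddCommGroup M]
    [Module A M] (N : Submodule A M) :
    Module.length A (M →ₗ[A] W) ≤ Module.length A ((M ⧸ N) →ₗ[A] W) +
      Module.length A (N →ₗ[A] W) := by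
  refine length_le_add_of_exact (LinearMap.lcomp A W N.mkQ) (LinearMap.lcomp A W N.subtype) ?_
  intro f hf
  refine ⟨N.liftQ f fun x hx => ?_, ?_⟩
  · exact LinearMap.congr_fun hf ⟨x, hx⟩
  · ext x; rfl

/-- The linear map from the cyclic module `A ⧸ I` which sends `1` to `w`. -/
def quotToSpan {W : Type*} [AddCommGroup W] [Module A W] {I : Ideal A} (w : W)
    (h : ∀ a ∈ I, a • w = 0) : (A ⧸ I) →ₗ[A] W :=
  Submodule.liftQ I (LinearMap.toSpanSingleton A W w) (fun a ha => by simpa using h a ha)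

@[simp]
theorem quotToSpan_mk {W : Type*} [AddCommGroup W] [Module A W] {I : Ideal A} (w : W)
    (h : ∀ a ∈ I, a • w = 0) (a : A) : quotToSpan w h (Ideal.Quotient.mk I a) = a • w := rfl

@[simp]
theorem quotToSpan_one {W : Type*} [AddCommGroup W] [Module A W] {I : Ideal A} (w : W)
    (h : ∀ a ∈ I, a • w = 0) : quotToSpan w h 1 = w :=
  (quotToSpan_mk w h 1).trans (one_smul _ _)

theorem length_pi_le_length_hom {W : Type*} [AddCommGroup W] [Module A W] {I : Ideal A}
    (hW : ∀ a ∈ I, ∀ x : W, a • x = 0) (n : ℕ) :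
    Module.length A (Fin n → W) ≤ Module.length A ((Fin n → (A ⧸ I)) →ₗ[A] W) := by
  let g : W →ₗ[A] ((A ⧸ I) →ₗ[A] W) :=
    { toFun := fun w => quotToSpan w fun a ha => hW a ha w
      map_add' := fun x y => by ext; simp
      map_smul' := fun r x => by ext; simp }
  have hg : Function.Injective g := fun x y h => by
    simpa [g] using LinearMap.congr_fun h 1
  let G : (Fin n → W) →ₗ[A] (Fin n → ((A ⧸ I) →ₗ[A] W)) :=
    LinearMap.pi fun i => g.comp (LinearMap.proj i)
  have hG : Function.Injective G := fun x y h => by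
    ext i
    exact hg (congrFun h i)
  exact Module.length_le_of_injective
    ((LinearMap.lsum A (fun _ : Fin n => (A ⧸ I)) A (M := W)).toLinearMap.comp G)
    ((LinearMap.lsum A (fun _ : Fin n => (A ⧸ I)) A (M := W)).injective.comp hG)

variable [IsLocalRing A]

/-- `u` generates the socle of `W`, which is simple. -/
structure IsSocleGenerator (A : Type u) [CommRing A] [IsLocalRing A] {W : Type v} [AddCommGroup W]
    [Module A W] (u : W) : Prop where
  smul_eq_zero : ∀ a ∈ maximalIdeal A, a • u = 0
  ne_zero : u ≠ 0
  exists_smul_eq : ∀ x : W, (∀ a ∈ maximalIdeal A, a • x = 0) → ∃ r : A, x = r • u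

section

variable {W : Type v} [AddCommGroup W] [Module A W] {u : W}

theorem IsSocleGenerator.length_hom_simple_le (hu : IsSocleGenerator A u) (D : Type w)
    [AddCommGroup D] [Module A D] [IsSimpleModule A D] :
    Module.length A (D →ₗ[A] W) ≤ 1 := by
  obtain ⟨I, hI, ⟨e⟩⟩ := isSimpleModule_iff_quot_maximal.mp ‹IsSimpleModule A D›
  obtain rfl := IsLocalRing.eq_maximalIdeal hI
  have hS : IsSimpleModule A (A ⧸ maximalIdeal A) :=
    isSimpleModule_iff_quot_maximal.mpr ⟨_, hI, ⟨LinearEquiv.refl _ _⟩⟩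
  have h1 : Module.length A (D →ₗ[A] W) ≤ Module.length A (A ∙ u) := by
    let ev : (D →ₗ[A] W) →ₗ[A] W := LinearMap.applyₗ (e.symm (Submodule.Quotient.mk 1))
    have hev : ∀ f, ev f ∈ A ∙ u := by
      intro f
      obtain ⟨r, hr⟩ := hu.exists_smul_eq (ev f) (by
        intro a ha
        have : a • (Submodule.Quotient.mk 1 : A ⧸ maximalIdeal A) = 0 := by
          rw [← Submodule.Quotient.mk_smul, Submodule.Quotient.mk_eq_zero]
          simpa using ha
        simp only [ev, LinearMap.applyₗ_apply_apply]
        rw [← map_smul, ← map_smul, this, map_zero, map_zero])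
      exact Submodule.mem_span_singleton.mpr ⟨r, hr.symm⟩
    refine Module.length_le_of_injective (ev.codRestrict _ hev) ?_
    intro f g hfg
    have h2 : ev f = ev g := congrArg Subtype.val hfg
    ext d
    obtain ⟨y, rfl⟩ := e.symm.surjective d
    obtain ⟨a, rfl⟩ := Submodule.Quotient.mk_surjective _ y
    have : (Submodule.Quotient.mk a : A ⧸ maximalIdeal A) = a • Submodule.Quotient.mk 1 := by
      rw [← Submodule.Quotient.mk_smul]; simp
    rw [this]
    simp only [map_smul]
    exact congrArg (a • ·) h2
  refine h1.trans ?_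
  rw [← Module.length_eq_one A (A ⧸ maximalIdeal A)]
  let g : (A ⧸ maximalIdeal A) →ₗ[A] (A ∙ u) :=
    quotToSpan ⟨u, Submodule.mem_span_singleton_self u⟩ (fun a ha => by
      ext
      exact hu.smul_eq_zero a ha)
  refine Module.length_le_of_surjective g ?_
  rintro ⟨x, hx⟩
  obtain ⟨r, rfl⟩ := Submodule.mem_span_singleton.mp hx
  exact ⟨Ideal.Quotient.mk _ r, by simp [g]⟩

/-- Dévissage to simple modules, whose maps to W land in the simple socle. No injectivity of W is
needed for this direction. -/
theorem IsSocleGenerator.length_hom_le (hu : IsSocleGenerator A u) {D : Type w}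
    [AddCommGroup D] [Module A D] (hD : IsFiniteLength A D) :
    Module.length A (D →ₗ[A] W) ≤ Module.length A D := by
  induction hD with
  | of_subsingleton =>
    rw [Module.length_eq_zero]
    exact zero_le
  | @of_simple_quotient M _ _ N hs _ ih =>
    refine (length_hom_le_add N).trans ?_
    rw [Module.length_eq_add_of_exact N.subtype N.mkQ N.injective_subtype N.mkQ_surjective
      (LinearMap.exact_subtype_mkQ N), add_comm, Module.length_eq_one A (M ⧸ N)]
    exact add_le_add ih (hu.length_hom_simple_le _)

/-- A module with simple socle which is killed by `I` and at least as long as `A ⧸ I` is a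
cogenerator for the finite `A ⧸ I`-modules. -/
theorem IsSocleGenerator.exists_hom_apply_ne_zero (hu : IsSocleGenerator A u) {I : Ideal A}
    (hW : ∀ a ∈ I, ∀ x : W, a • x = 0) (hI : Module.length A (A ⧸ I) ≠ ⊤)
    (hlen : Module.length A (A ⧸ I) ≤ Module.length A W) {Q : Type w} [AddCommGroup Q]
    [Module A Q] [Module.Finite A Q] (hQ : ∀ a ∈ I, ∀ x : Q, a • x = 0) {b : Q} (hb : b ≠ 0) :
    ∃ f : Q →ₗ[A] W, f b ≠ 0 := by
  -- If every map Q → W kills b, then Hom(Q, W) = Hom(Q/Ab, W). For a free cover F of Q over A/I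
  -- with kernel X this gives ℓ(F) ≤ ℓ(Hom(F, W)) ≤ ℓ(Q/Ab) + ℓ(X) < ℓ(Q) + ℓ(X) = ℓ(F).
  by_contra! hcon
  obtain ⟨n, s, hs⟩ := Module.Finite.exists_fin (R := A) (M := Q)
  let π : (Fin n → (A ⧸ I)) →ₗ[A] Q :=
    LinearMap.lsum A (fun _ : Fin n => (A ⧸ I)) A fun i =>
      quotToSpan (s i) fun a ha => hQ a ha (s i)
  have hπ : Function.Surjective π := by
    rw [← LinearMap.range_eq_top, eq_top_iff, ← hs, Submodule.span_le]
    rintro _ ⟨i, rfl⟩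
    exact ⟨Pi.single i 1, by simp [π, LinearMap.lsum_apply, Pi.single_apply, apply_ite]⟩
  have hF : Module.length A (Fin n → (A ⧸ I)) ≠ ⊤ := by
    rw [Module.length_pi_of_fintype]
    exact Finset.sum_induction _ (· ≠ ⊤) (fun a b ha hb => by simp [ha, hb]) (by simp)
      (fun _ _ => hI)
  have hexact := Module.length_eq_add_of_exact (LinearMap.ker π).subtype π
    (LinearMap.ker π).injective_subtype hπ (LinearMap.exact_subtype_ker_map π)
  have hQlen := Module.length_eq_add_of_exact (A ∙ b).subtype (A ∙ b).mkQ
    (A ∙ b).injective_subtype (A ∙ b).mkQ_surjective (LinearMap.exact_subtype_mkQ _)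
  have hQ' : Module.length A Q ≠ ⊤ := fun h => hF (by rw [hexact, h, add_top])
  have hX : Module.length A (LinearMap.ker π) ≠ ⊤ := fun h => hF (by rw [hexact, h, top_add])
  have hQb : Module.length A (Q ⧸ (A ∙ b)) ≠ ⊤ := fun h => hQ' (by rw [hQlen, h, add_top])
  have hAb : Module.length A (A ∙ b) ≠ 0 := by
    rw [Ne, Module.length_eq_zero_iff]
    intro h
    exact hb (congrArg Subtype.val (Subsingleton.elim
      (⟨b, Submodule.mem_span_singleton_self b⟩ : A ∙ b) 0))
  have h1 : Module.length A (Fin n → (A ⧸ I)) ≤ Module.length A (Fin n → W) := by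
    rw [Module.length_pi_of_fintype, Module.length_pi_of_fintype]
    exact Finset.sum_le_sum fun _ _ => hlen
  have h2 := length_pi_le_length_hom hW n
  have h3 : Module.length A ((Fin n → (A ⧸ I)) →ₗ[A] W) ≤
      Module.length A ((Q ⧸ (A ∙ b)) →ₗ[A] W) + Module.length A (LinearMap.ker π →ₗ[A] W) := by
    refine length_le_add_of_exact (LinearMap.lcomp A W ((A ∙ b).mkQ.comp π))
      (LinearMap.lcomp A W (LinearMap.ker π).subtype) fun f hf => ?_
    let f1 : Q →ₗ[A] W := ((LinearMap.ker π).liftQ f fun x hx =>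
      LinearMap.congr_fun hf ⟨x, hx⟩).comp (π.quotKerEquivOfSurjective hπ).symm.toLinearMap
    have hf1 : ∀ x, f1 (π x) = f x := fun x => by
      have : (π.quotKerEquivOfSurjective hπ).symm (π x) = Submodule.Quotient.mk x := by
        rw [LinearEquiv.symm_apply_eq]; rfl
      simp only [f1, LinearMap.comp_apply, LinearEquiv.coe_coe, this]
      rfl
    refine ⟨(A ∙ b).liftQ f1 ?_, ?_⟩
    · rw [Submodule.span_singleton_le_iff_mem]
      exact hcon f1
    · exact LinearMap.ext hf1
  have h4 := hu.length_hom_le (Module.length_ne_top_iff.mp hQb)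
  have h5 := hu.length_hom_le (Module.length_ne_top_iff.mp hX)
  have h6 := (h1.trans (h2.trans h3)).trans (add_le_add h4 h5)
  rw [hexact, hQlen] at h6
  generalize Module.length A (Q ⧸ (A ∙ b)) = x at *
  generalize Module.length A (LinearMap.ker π) = y at *
  have hz : Module.length A (A ∙ b) ≠ ⊤ := fun h => hQ' (by rw [hQlen, h, top_add])
  generalize Module.length A (A ∙ b) = z at *
  lift x to ℕ using hQb
  lift y to ℕ using hX
  lift z to ℕ using hz
  norm_cast at h6 hAb
  omega

end

end Duality

/-! ### Splitting detected by finite length cogenerators. -/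

section SplittingCriterion

open scoped TensorProduct

/-- A map `A ⧸ J → N`, `1 ↦ x`, splits if it is injective after tensoring with suitable
cogenerators for a cofinal system of finite length quotients of `A ⧸ J`. -/
theorem exists_hom_apply_eq_one {A : Type u} [CommRing A] [IsLocalRing A] [IsNoetherianRing A]
    {N : Type v} [AddCommGroup N] [Module A N] [Module.Finite A N] (x : N) (J : Ideal A)
    (h : ∀ k : ℕ, ∃ I : Ideal A, I ≤ J ⊔ maximalIdeal A ^ k ∧ Module.length A (A ⧸ I) ≠ ⊤ ∧
      ∃ (W : Type w) (_ : AddCommGroup W) (_ : Module A W) (u : W), IsSocleGenerator A u ∧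
        (∀ a ∈ I, ∀ y : W, a • y = 0) ∧ Module.length A (A ⧸ I) ≤ Module.length A W ∧
        ∀ y : W, x ⊗ₜ[A] y = 0 → y = 0) :
    ∃ φ : N →ₗ[A] A ⧸ J, φ x = 1 := by
  obtain ⟨n, f, hf⟩ := Module.Finite.exists_fin' A N
  obtain ⟨ξ, rfl⟩ := hf x
  obtain ⟨m, g0, hg0⟩ := Module.Finite.exists_fin' A (LinearMap.ker f)
  let e : Fin m → (Fin n → A) := fun i => (g0 (Pi.single i 1) : LinearMap.ker f)
  have he : ∀ i, f (e i) = 0 := fun i => (g0 (Pi.single i 1)).2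
  let lc : (Fin n → (A ⧸ J)) → (Fin n → A) →ₗ[A] A ⧸ J := fun ρ => Fintype.linearCombination A ρ
  -- With f as generators and e as relations of N, a map N → A/J is a tuple ρ killing every e i; it
  -- takes x to 1 exactly when Ψ ρ = (0, 1).
  let Ψ : (Fin n → (A ⧸ J)) →ₗ[A] (Fin m → (A ⧸ J)) × (A ⧸ J) :=
    { toFun := fun ρ => (fun i => lc ρ (e i), lc ρ ξ)
      map_add' := fun ρ σ => by
        ext <;> simp [lc, Fintype.linearCombination_apply, Finset.sum_add_distrib]
      map_smul' := fun r ρ => by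
        ext <;> simp [lc, Fintype.linearCombination_apply, Finset.smul_sum, smul_comm r] }
  by_cases hΨ : ((0, 1) : (Fin m → (A ⧸ J)) × (A ⧸ J)) ∈ LinearMap.range Ψ
  · obtain ⟨ρ, hρ⟩ := hΨ
    have hker : LinearMap.ker f ≤ LinearMap.ker (lc ρ) := by
      intro y hy
      obtain ⟨c, hc⟩ := hg0 ⟨y, hy⟩
      have hy' : y = ∑ i, c i • e i := by
        have h1 : y = (g0 c : LinearMap.ker f) := by rw [hc]
        have h2 : c = ∑ i, c i • (Pi.single i 1 : Fin m → A) := by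
          ext j; simp [Finset.sum_apply, Pi.single_apply]
        rw [h1, h2, map_sum]
        simp [e, Pi.single_apply]
      rw [LinearMap.mem_ker, hy', map_sum]
      refine Finset.sum_eq_zero fun i _ => ?_
      rw [map_smul]
      have : lc ρ (e i) = 0 := congrFun (congrArg Prod.fst hρ) i
      rw [this, smul_zero]
    refine ⟨((LinearMap.ker f).liftQ (lc ρ) hker).comp
      (f.quotKerEquivOfSurjective hf).symm.toLinearMap, ?_⟩
    have : (f.quotKerEquivOfSurjective hf).symm (f ξ) = Submodule.Quotient.mk ξ := by
      rw [LinearEquiv.symm_apply_eq]; rfl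
    simp only [LinearMap.comp_apply, LinearEquiv.coe_coe, this]
    exact congrArg Prod.snd hρ
  · exfalso
    set D := (Fin m → (A ⧸ J)) × (A ⧸ J)
    -- An unsolvable linear system is already unsolvable modulo some power of the maximal ideal; a
    -- functional into W then witnesses this.
    have hKrull := Ideal.iInf_pow_smul_eq_bot_of_isLocalRing (M := D ⧸ LinearMap.range Ψ)
      (maximalIdeal A) (maximalIdeal.isMaximal A).ne_top
    have hb : (Submodule.Quotient.mk (0, 1) : D ⧸ LinearMap.range Ψ) ∉
        (⨅ i : ℕ, maximalIdeal A ^ i • ⊤ : Submodule A (D ⧸ LinearMap.range Ψ)) := by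
      rw [hKrull, Submodule.mem_bot, Submodule.Quotient.mk_eq_zero]
      exact hΨ
    rw [Submodule.mem_iInf] at hb
    push Not at hb
    obtain ⟨k, hk⟩ := hb
    obtain ⟨I, hI, hlenI, W, _, _, u, hu, hW, hlen, hx⟩ := h k
    have hle : (I • ⊤ : Submodule A (D ⧸ LinearMap.range Ψ)) ≤ maximalIdeal A ^ k • ⊤ := by
      rw [Submodule.smul_le]
      rintro a ha d -
      obtain ⟨j, hj, c, hc, rfl⟩ := Submodule.mem_sup.mp (hI ha)
      rw [add_smul]
      refine add_mem ?_ (Submodule.smul_mem_smul hc trivial)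
      have hj0 : ∀ y : A ⧸ J, j • y = 0 := by
        intro y
        obtain ⟨y, rfl⟩ := Ideal.Quotient.mk_surjective y
        rw [← Ideal.Quotient.mk_eq_mk, ← Submodule.Quotient.mk_smul, Submodule.Quotient.mk_eq_zero]
        exact J.mul_mem_right _ hj
      obtain ⟨d, rfl⟩ := Submodule.Quotient.mk_surjective _ d
      have : j • d = 0 := by
        ext
        · exact hj0 _
        · exact hj0 _
      rw [← Submodule.Quotient.mk_smul, this, Submodule.Quotient.mk_zero]
      exact zero_mem _
    let Q := (D ⧸ LinearMap.range Ψ) ⧸ (I • ⊤ : Submodule A (D ⧸ LinearMap.range Ψ))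
    obtain ⟨l, hl⟩ := hu.exists_hom_apply_ne_zero hW hlenI hlen (Q := Q)
      (fun a ha q => by
        obtain ⟨q, rfl⟩ := Submodule.Quotient.mk_surjective _ q
        rw [← Submodule.Quotient.mk_smul, Submodule.Quotient.mk_eq_zero]
        exact Submodule.smul_mem_smul ha trivial)
      (b := Submodule.Quotient.mk (Submodule.Quotient.mk (0, 1)))
      (fun h0 => hk (hle ((Submodule.Quotient.mk_eq_zero _).mp h0)))
    let l' : D →ₗ[A] W :=
      l.comp ((Submodule.mkQ _).comp (LinearMap.range Ψ).mkQ)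
    have hl'Ψ : ∀ ρ, l' (Ψ ρ) = 0 := by
      intro ρ
      have : (LinearMap.range Ψ).mkQ (Ψ ρ) = 0 :=
        (Submodule.Quotient.mk_eq_zero _).mpr ⟨ρ, rfl⟩
      simp only [l', LinearMap.comp_apply, this, map_zero]
    refine hl (hx (l' (0, 1)) ?_)
    -- That l' vanishes on the image of Ψ rewrites x ⊗ l'(0, 1) as a combination of the f (e i) ⊗
    -- l'(Pi.single i 1, 0), all zero because e i is a relation.
    have hrel : ∀ j, ξ j • l' (0, 1) = - ∑ i, e i j • l' (Pi.single i 1, 0) := by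
      intro j
      rw [eq_neg_iff_add_eq_zero, ← hl'Ψ (Pi.single j 1)]
      have : Ψ (Pi.single j 1) = ξ j • (0, 1) + ∑ i, e i j • (Pi.single i 1, 0) := by
        ext i
        · simp [Ψ, lc, Fintype.linearCombination_apply, Pi.single_apply, Prod.fst_sum]
        · simp [Ψ, lc, Fintype.linearCombination_apply, Pi.single_apply, Prod.snd_sum]
      rw [this, map_add, map_smul, map_sum]
      simp only [map_smul]
    have hfsum : ∀ y : Fin n → A, f y = ∑ j, y j • f (Pi.single j 1) := by
      intro y
      conv_lhs => rw [pi_eq_sum_univ' y]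
      simp [map_sum]
    rw [hfsum ξ, TensorProduct.sum_tmul]
    simp_rw [TensorProduct.smul_tmul, hrel, TensorProduct.tmul_neg, TensorProduct.tmul_sum]
    rw [Finset.sum_neg_distrib, Finset.sum_comm, neg_eq_zero]
    refine Finset.sum_eq_zero fun i _ => ?_
    simp_rw [← TensorProduct.smul_tmul]
    rw [← TensorProduct.sum_tmul, ← hfsum, he, TensorProduct.zero_tmul]

end SplittingCriterion

/-! ### Flatness of quotients by sequences regular on the closed fiber. -/

section FlatQuotient

variable {R : Type u} {S : Type v} [CommRing R] [CommRing S] [Algebra R S]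

theorem sum_smul_mk_eq (𝔟 : Ideal S) {n : ℕ} (f : Fin n → R) (x : Fin n → S) :
    ∑ i, f i • Ideal.Quotient.mk 𝔟 (x i) =
      Ideal.Quotient.mk 𝔟 (∑ i, algebraMap R S (f i) * x i) := by
  rw [map_sum]
  refine Finset.sum_congr rfl fun i _ => ?_
  rw [map_mul, Algebra.smul_def]; rfl

theorem exists_trivial_relation_mod (𝔟 : Ideal S) [Module.Flat R (S ⧸ 𝔟)] {n : ℕ} {f : Fin n → R}
    {x : Fin n → S} (h : ∑ i, algebraMap R S (f i) * x i ∈ 𝔟) :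
    ∃ (k : ℕ) (c : Fin n → Fin k → R) (w : Fin k → S),
      (∀ i, x i - ∑ j, algebraMap R S (c i j) * w j ∈ 𝔟) ∧ ∀ j, ∑ i, f i * c i j = 0 := by
  obtain ⟨k, c, w, hw, hc⟩ := Module.Flat.isTrivialRelation_of_sum_smul_eq_zero (R := R)
    (M := S ⧸ 𝔟) (f := f) (x := fun i => Ideal.Quotient.mk 𝔟 (x i)) (by
      rw [sum_smul_mk_eq, Ideal.Quotient.eq_zero_iff_mem]
      exact h)
  choose w' hw' using fun j => Ideal.Quotient.mk_surjective (w j)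
  refine ⟨k, c, w', fun i => ?_, hc⟩
  have := hw i
  simp_rw [← hw'] at this
  rwa [sum_smul_mk_eq, Ideal.Quotient.eq] at this

theorem flat_of_trivial_relation_mod (𝔟 : Ideal S)
    (h : ∀ (n : ℕ) (f : Fin n → R) (x : Fin n → S), ∑ i, algebraMap R S (f i) * x i ∈ 𝔟 →
      ∃ (k : ℕ) (c : Fin n → Fin k → R) (w : Fin k → S),
      (∀ i, x i - ∑ j, algebraMap R S (c i j) * w j ∈ 𝔟) ∧ ∀ j, ∑ i, f i * c i j = 0) :
    Module.Flat R (S ⧸ 𝔟) := by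
  refine Module.Flat.of_forall_isTrivialRelation fun {l f x} hfx => ?_
  choose x' hx' using fun i => Ideal.Quotient.mk_surjective (x i)
  simp_rw [← hx'] at hfx
  rw [sum_smul_mk_eq, Ideal.Quotient.eq_zero_iff_mem] at hfx
  obtain ⟨k, c, w, hw, hc⟩ := h l f x' hfx
  refine ⟨k, c, fun j => Ideal.Quotient.mk _ (w j), fun i => ?_, hc⟩
  rw [← hx', sum_smul_mk_eq, Ideal.Quotient.eq]
  exact hw i
theorem mem_map_span_range_sup_iff {n : ℕ} (f : Fin n → R) (𝔟 : Ideal S) (x : S) :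
    x ∈ (Ideal.span (Set.range f)).map (algebraMap R S) ⊔ 𝔟 ↔
      ∃ y : Fin n → S, x - ∑ i, algebraMap R S (f i) * y i ∈ 𝔟 := by
  rw [Ideal.map_span, ← Set.range_comp, Submodule.mem_sup]
  constructor
  · rintro ⟨a, ha, b, hb, rfl⟩
    obtain ⟨c, rfl⟩ := Ideal.mem_span_range_iff_exists_fun.mp ha
    refine ⟨c, ?_⟩
    simpa [mul_comm] using hb
  · rintro ⟨y, hy⟩
    refine ⟨_, Ideal.mem_span_range_iff_exists_fun.mpr ⟨y, rfl⟩, _, hy, ?_⟩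
    simp [mul_comm]

/-- If `S ⧸ 𝔟` is flat over `R` and `a` is regular on all `S ⧸ (IS + 𝔟)`, then `S ⧸ (𝔟 + aS)` is
flat over `R`. -/
theorem flat_quotient_sup_span_singleton (𝔟 : Ideal S) [Module.Flat R (S ⧸ 𝔟)] (a : S)
    (ha : ∀ (I : Ideal R) (x : S), a * x ∈ I.map (algebraMap R S) ⊔ 𝔟 →
      x ∈ I.map (algebraMap R S) ⊔ 𝔟) :
    Module.Flat R (S ⧸ (𝔟 ⊔ Ideal.span {a})) := by
  refine flat_of_trivial_relation_mod _ fun n f x hfx => ?_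
  obtain ⟨b, hb, y, hy⟩ := mem_sup_span_singleton.mp hfx
  have h1 := ha (Ideal.span (Set.range f)) y ((mem_map_span_range_sup_iff f 𝔟 _).mpr
    ⟨x, by rw [hy]; simpa using hb⟩)
  obtain ⟨z, hz⟩ := (mem_map_span_range_sup_iff f 𝔟 y).mp h1
  have hrel : ∑ i, algebraMap R S (f i) * (x i - a * z i) ∈ 𝔟 := by
    have : ∑ i, algebraMap R S (f i) * (x i - a * z i) =
        b + a * (y - ∑ i, algebraMap R S (f i) * z i) := by
      simp_rw [mul_sub, Finset.sum_sub_distrib, hy, Finset.mul_sum]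
      rw [add_sub_assoc]
      congr 2
      exact Finset.sum_congr rfl fun i _ => by ring
    rw [this]
    exact 𝔟.add_mem hb (𝔟.mul_mem_left _ hz)
  obtain ⟨k, c, w, hw, hc⟩ := exists_trivial_relation_mod 𝔟 hrel
  exact ⟨k, c, w, fun i => mem_sup_span_singleton.mpr ⟨_, hw i, z i, by ring⟩, hc⟩

theorem mem_of_forall_mem_sup_pow [IsLocalRing S] [IsNoetherianRing S] (I : Ideal S) {x : S}
    (h : ∀ k : ℕ, x ∈ I ⊔ maximalIdeal S ^ k) : x ∈ I := by
  have hKrull := Ideal.iInf_pow_smul_eq_bot_of_isLocalRing (M := S ⧸ I)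
      (maximalIdeal S) (maximalIdeal.isMaximal S).ne_top
  rw [← Ideal.Quotient.eq_zero_iff_mem, ← Submodule.mem_bot (R := S), ← hKrull,
    Submodule.mem_iInf]
  intro k
  obtain ⟨i, hi, y, hy, rfl⟩ := Submodule.mem_sup.mp (h k)
  rw [map_add, Ideal.Quotient.eq_zero_iff_mem.mpr hi, zero_add]
  have : Ideal.Quotient.mk I y = y • (1 : S ⧸ I) := by
    rw [Algebra.smul_def, mul_one]; rfl
  rw [this]
  exact Submodule.smul_mem_smul hy trivial

section Local

variable [IsLocalRing R]

theorem exists_notMem_mul_mem_of_pow_le {I : Ideal R} (hI : I ≠ ⊤) {k : ℕ}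
    (hk : maximalIdeal R ^ k ≤ I) : ∃ r ∉ I, ∀ a ∈ maximalIdeal R, a * r ∈ I := by
  induction k with
  | zero => exact absurd (top_le_iff.mp (by simpa using hk)) hI
  | succ k ih =>
    by_cases h : maximalIdeal R ^ k ≤ I
    · exact ih h
    · obtain ⟨r, hr, hrI⟩ := Set.not_subset.mp h
      exact ⟨r, hrI, fun a ha => hk (by rw [pow_succ']; exact Ideal.mul_mem_mul ha hr)⟩

theorem map_maximalIdeal_le [IsLocalRing S] [IsLocalHom (algebraMap R S)] :
    (maximalIdeal R).map (algebraMap R S) ≤ maximalIdeal S :=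
  ((IsLocalRing.local_hom_TFAE (algebraMap R S)).out 0 2).mp ‹_›

variable [IsNoetherianRing R]

/-- Colons commute with flat base change: y lies in (I : r)S + 𝔟, and (I : r) is proper. The
equational criterion exhibits this, the coefficients c 0 j being elements of (I : r). -/
theorem mem_of_algebraMap_mul_mem (𝔟 : Ideal S) [Module.Flat R (S ⧸ 𝔟)] {I : Ideal R} {r : R}
    (hr : r ∉ I) {y : S} (hy : algebraMap R S r * y ∈ I.map (algebraMap R S) ⊔ 𝔟) :
    y ∈ (maximalIdeal R).map (algebraMap R S) ⊔ 𝔟 := by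
  obtain ⟨n, f, rfl⟩ := Submodule.fg_iff_exists_fin_generating_family.mp
    (IsNoetherian.noetherian I)
  obtain ⟨z, hz⟩ := (mem_map_span_range_sup_iff f 𝔟 _).mp hy
  obtain ⟨k, c, w, hw, hc⟩ := exists_trivial_relation_mod 𝔟
    (f := (Fin.cons r (fun i => - f i) : Fin (n + 1) → R))
    (x := (Fin.cons y z : Fin (n + 1) → S)) (by
      rw [Fin.sum_univ_succ]
      simpa [sub_eq_add_neg] using hz)
  have hc0 : ∀ j, c 0 j ∈ maximalIdeal R := by
    intro j
    by_contra hcj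
    have hunit : IsUnit (c 0 j) := by simpa using hcj
    refine hr ?_
    have h1 := hc j
    rw [Fin.sum_univ_succ] at h1
    simp only [Fin.cons_zero, Fin.cons_succ, neg_mul, Finset.sum_neg_distrib] at h1
    have h3 : c 0 j * r = ∑ i, f i * c i.succ j := by linear_combination h1
    rw [← Ideal.unit_mul_mem_iff_mem _ hunit, h3]
    exact Submodule.sum_mem _ fun i _ => Ideal.mul_mem_right _ _ (Ideal.subset_span ⟨i, rfl⟩)
  have h2 := hw 0
  rw [Fin.cons_zero] at h2
  rw [← sub_add_cancel y (∑ j, algebraMap R S (c 0 j) * w j)]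
  refine Ideal.add_mem _ (Ideal.mem_sup_right h2) (Ideal.mem_sup_left ?_)
  exact Submodule.sum_mem _ fun j _ => Ideal.mul_mem_right _ _ (Ideal.mem_map_of_mem _ (hc0 j))

/-- Noetherian induction from above: enlarge I by an r with m r ⊆ I. Modulo I, the part of x that is
a multiple of r is governed by the closed fiber, where a is regular by hypothesis. -/
theorem regular_of_pow_le (𝔟 : Ideal S) [Module.Flat R (S ⧸ 𝔟)] {a : S}
    (ha : ∀ x : S, a * x ∈ (maximalIdeal R).map (algebraMap R S) ⊔ 𝔟 →
      x ∈ (maximalIdeal R).map (algebraMap R S) ⊔ 𝔟) (k : ℕ) (I : Ideal R)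
    (hk : maximalIdeal R ^ k ≤ I) :
    ∀ x : S, a * x ∈ I.map (algebraMap R S) ⊔ 𝔟 → x ∈ I.map (algebraMap R S) ⊔ 𝔟 := by
  induction I using WellFoundedGT.induction with
  | ind I ih =>
    intro x hx
    by_cases hI : I = ⊤
    · simp [hI, Ideal.map_top]
    obtain ⟨r, hr, hmr⟩ := exists_notMem_mul_mem_of_pow_le hI hk
    have hlt : I < I ⊔ Ideal.span {r} := by
      refine lt_of_le_of_ne le_sup_left fun h => hr ?_
      rw [h]
      exact Ideal.mem_sup_right (Ideal.mem_span_singleton_self r)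
    have h1 := ih _ hlt (hk.trans le_sup_left) x
      ((sup_le_sup_right (Ideal.map_mono le_sup_left) 𝔟 :
        I.map (algebraMap R S) ⊔ 𝔟 ≤ (I ⊔ Ideal.span {r}).map (algebraMap R S) ⊔ 𝔟) hx)
    rw [Ideal.map_sup, Ideal.map_span, Set.image_singleton, sup_right_comm] at h1
    obtain ⟨s, hs, y, rfl⟩ := mem_sup_span_singleton.mp h1
    have h2 : algebraMap R S r * (a * y) ∈ I.map (algebraMap R S) ⊔ 𝔟 := by
      have : algebraMap R S r * (a * y) = a * (s + algebraMap R S r * y) - a * s := by ring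
      rw [this]
      exact Ideal.sub_mem _ hx (Ideal.mul_mem_left _ _ hs)
    have h3 := ha y (mem_of_algebraMap_mul_mem 𝔟 hr h2)
    refine Ideal.add_mem _ hs ?_
    have hle : ∀ y ∈ (maximalIdeal R).map (algebraMap R S) ⊔ 𝔟,
        algebraMap R S r * y ∈ I.map (algebraMap R S) ⊔ 𝔟 := by
      intro y hy
      obtain ⟨c, hc, b, hb, rfl⟩ := Submodule.mem_sup.mp hy
      rw [mul_add]
      refine Ideal.add_mem _ (Ideal.mem_sup_left ?_) (Ideal.mem_sup_right (𝔟.mul_mem_left _ hb))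
      have h4 : Ideal.span {algebraMap R S r} * (maximalIdeal R).map (algebraMap R S) ≤
          I.map (algebraMap R S) := by
        rw [← Set.image_singleton, ← Ideal.map_span, ← Ideal.map_mul]
        refine Ideal.map_mono (Ideal.mul_le.mpr fun x hx c hc => ?_)
        obtain ⟨d, rfl⟩ := Ideal.mem_span_singleton'.mp hx
        rw [mul_assoc, mul_comm r c]
        exact I.mul_mem_left _ (hmr c hc)
      exact h4 (Ideal.mul_mem_mul (Ideal.mem_span_singleton_self _) hc)
    exact hle y h3

variable [IsLocalRing S] [IsNoetherianRing S] [IsLocalHom (algebraMap R S)]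

/-- Replace I by I + m^k, which contains a power of m, and let k grow; Krull's intersection theorem
in S recovers I. -/
theorem regular_of_regular_maximalIdeal (𝔟 : Ideal S) [Module.Flat R (S ⧸ 𝔟)] {a : S}
    (ha : ∀ x : S, a * x ∈ (maximalIdeal R).map (algebraMap R S) ⊔ 𝔟 →
      x ∈ (maximalIdeal R).map (algebraMap R S) ⊔ 𝔟) (I : Ideal R) :
    ∀ x : S, a * x ∈ I.map (algebraMap R S) ⊔ 𝔟 → x ∈ I.map (algebraMap R S) ⊔ 𝔟 := by
  intro x hx
  refine mem_of_forall_mem_sup_pow _ fun k => ?_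
  have hle : I.map (algebraMap R S) ⊔ 𝔟 ≤
      (I ⊔ maximalIdeal R ^ k).map (algebraMap R S) ⊔ 𝔟 :=
    sup_le_sup_right (Ideal.map_mono le_sup_left) 𝔟
  have h := regular_of_pow_le 𝔟 ha k (I ⊔ maximalIdeal R ^ k) le_sup_right x (hle hx)
  refine (?_ : (I ⊔ maximalIdeal R ^ k).map (algebraMap R S) ⊔ 𝔟 ≤ _) h
  rw [Ideal.map_sup, Ideal.map_pow, sup_right_comm]
  exact sup_le_sup_left (Ideal.pow_right_mono map_maximalIdeal_le k) _

/-- If `S ⧸ 𝔟` is flat over `R`, then so is its quotient by a sequence which is regular on the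
closed fiber of `S ⧸ 𝔟`. -/
theorem RegularMod.flat_quotient {l : List S} (𝔟 : Ideal S) [hf : Module.Flat R (S ⧸ 𝔟)]
    (hl : RegularMod ((maximalIdeal R).map (algebraMap R S) ⊔ 𝔟) l) :
    Module.Flat R (S ⧸ (𝔟 ⊔ Ideal.ofList l)) := by
  induction l generalizing 𝔟 with
  | nil =>
    rw [Ideal.ofList_nil, sup_bot_eq]
    exact hf
  | cons a l ih =>
    have := flat_quotient_sup_span_singleton (R := R) 𝔟 a
      (regular_of_regular_maximalIdeal 𝔟 hl.1)
    rw [Ideal.ofList_cons, ← sup_assoc]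
    refine ih (𝔟 ⊔ Ideal.span {a}) ?_
    rw [← sup_assoc]
    exact hl.2

theorem RegularMod.flat_quotient_ofList [Module.Flat R S] {l : List S}
    (hl : RegularMod ((maximalIdeal R).map (algebraMap R S)) l) :
    Module.Flat R (S ⧸ Ideal.ofList l) := by
  have : Module.Flat R (S ⧸ (⊥ : Ideal S)) :=
    Module.Flat.of_linearEquiv ((AlgEquiv.quotientBot R S).toLinearEquiv)
  have h := RegularMod.flat_quotient (R := R) (⊥ : Ideal S) (l := l) (by rwa [sup_bot_eq])
  rwa [bot_sup_eq] at h

end Local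

end FlatQuotient

/-! ### Finite length of quotients by ideals containing a power of the maximal ideal. -/

section FiniteLengthQuotient

theorem length_quotient_ne_top_of_pow_le {A : Type u} [CommRing A] [IsLocalRing A]
    [IsNoetherianRing A] {I : Ideal A} {k : ℕ} (h : maximalIdeal A ^ k ≤ I) :
    Module.length A (A ⧸ I) ≠ ⊤ := by
  by_cases hI : I = ⊤
  · subst hI
    have : Subsingleton (A ⧸ (⊤ : Ideal A)) := Ideal.Quotient.subsingleton_iff.mpr rfl
    rw [Module.length_eq_zero]
    exact ENat.zero_ne_top
  have : Nontrivial (A ⧸ I) := Ideal.Quotient.nontrivial_iff.mpr hI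
  have : IsLocalRing (A ⧸ I) :=
    IsLocalRing.of_surjective' (Ideal.Quotient.mk _) Ideal.Quotient.mk_surjective
  have : IsArtinianRing (A ⧸ I) := by
    rw [isArtinianRing_iff_isNilpotent_maximalIdeal]
    refine ⟨k, ?_⟩
    rw [Ideal.zero_eq_bot, ← le_bot_iff,
      ← Ideal.map_comap_of_surjective _ Ideal.Quotient.mk_surjective (maximalIdeal (A ⧸ I)),
      ← Ideal.map_pow, Ideal.map_le_iff_le_comap, ← RingHom.ker_eq_comap_bot, Ideal.mk_ker]
    refine le_trans (Ideal.pow_right_mono ?_ k) h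
    exact IsLocalRing.le_maximalIdeal (Ideal.comap_ne_top _ (maximalIdeal.isMaximal _).ne_top)
  rw [Module.length_eq_of_surjective (R := A ⧸ I) Ideal.Quotient.mk_surjective]
  exact Module.length_ne_top

end FiniteLengthQuotient

/-! ### Length and socle under flat base change. -/

section FlatTensor

open scoped TensorProduct

variable {R : Type u} {S : Type v} [CommRing R] [CommRing S] [Algebra R S]

theorem length_tensor {T : Type*} [AddCommGroup T] [Module R T] [Module S T] [IsScalarTower R S T]
    [Module.Flat R T] [IsLocalRing R] {N : Type w} [AddCommGroup N] [Module R N]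
    (hN : IsFiniteLength R N) :
    Module.length S (T ⊗[R] N) =
      Module.length R N * Module.length S (T ⊗[R] (R ⧸ maximalIdeal R)) := by
  induction hN with
  | of_subsingleton => rw [Module.length_eq_zero, Module.length_eq_zero, zero_mul]
  | @of_simple_quotient M _ _ N hs _ ih =>
    obtain ⟨I, hI, ⟨e⟩⟩ := isSimpleModule_iff_quot_maximal.mp hs
    obtain rfl := IsLocalRing.eq_maximalIdeal hI
    rw [Module.length_eq_add_of_exact N.subtype N.mkQ N.injective_subtype N.mkQ_surjective
      (LinearMap.exact_subtype_mkQ N), Module.length_eq_one R (M ⧸ N), add_mul, one_mul, ← ih,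
      ← (TensorProduct.AlgebraTensorModule.congr (LinearEquiv.refl S T) e).length_eq]
    refine Module.length_eq_add_of_exact (TensorProduct.AlgebraTensorModule.lTensor S T N.subtype)
      (TensorProduct.AlgebraTensorModule.lTensor S T N.mkQ) ?_ ?_ ?_
    · exact Module.Flat.lTensor_preserves_injective_linearMap N.subtype N.injective_subtype
    · exact LinearMap.lTensor_surjective T N.mkQ_surjective
    · exact Module.Flat.lTensor_exact T (LinearMap.exact_subtype_mkQ N)

/-- The tensor product of `S ⧸ 𝔟` with `R ⧸ I` maps onto `S ⧸ (IS + 𝔟)`. -/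
theorem length_quotient_sup_le (𝔟 : Ideal S) (I : Ideal R) :
    Module.length S (S ⧸ (I.map (algebraMap R S) ⊔ 𝔟)) ≤
      Module.length S ((S ⧸ 𝔟) ⊗[R] (R ⧸ I)) := by
  let Q := S ⧸ (I.map (algebraMap R S) ⊔ 𝔟)
  let f : (R ⧸ I) →ₗ[R] Q := quotToSpan (1 : Q) (fun a ha => by
    rw [Algebra.smul_def, mul_one]
    exact Ideal.Quotient.eq_zero_iff_mem.mpr (Ideal.mem_sup_left (Ideal.mem_map_of_mem _ ha)))
  let g : (S ⧸ 𝔟) →ₗ[S] Q := quotToSpan (1 : Q) (fun a ha => by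
    rw [Algebra.smul_def, mul_one]
    exact Ideal.Quotient.eq_zero_iff_mem.mpr (Ideal.mem_sup_right ha))
  let F : (S ⧸ 𝔟) ⊗[R] (R ⧸ I) →ₗ[S] Q := TensorProduct.AlgebraTensorModule.lift
    { toFun := fun s => (LinearMap.mul R Q (g s)).comp f
      map_add' := fun s t => by ext; simp
      map_smul' := fun r s => by ext; simp }
  refine Module.length_le_of_surjective F fun q => ?_
  obtain ⟨s, rfl⟩ := Ideal.Quotient.mk_surjective q
  refine ⟨(Ideal.Quotient.mk 𝔟 s) ⊗ₜ 1, ?_⟩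
  simp only [F, TensorProduct.AlgebraTensorModule.lift_tmul]
  simp only [LinearMap.coe_mk, AddHom.coe_mk, LinearMap.comp_apply, LinearMap.mul_apply', f, g,
    quotToSpan_mk, quotToSpan_one, mul_one]
  rw [Algebra.smul_def, mul_one]; rfl

variable [IsLocalRing R]

theorem mk_tmul_eq_zero (𝔟 : Ideal S) {N : Type w} [AddCommGroup N] [Module R N] {ξ : N}
    (hξ : ∀ a ∈ maximalIdeal R, a • ξ = 0) {s : S}
    (hs : s ∈ (maximalIdeal R).map (algebraMap R S) ⊔ 𝔟) :
    (Ideal.Quotient.mk 𝔟 s) ⊗ₜ[R] ξ = 0 := by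
  let g : S →+ (S ⧸ 𝔟) ⊗[R] N :=
    ((TensorProduct.mk R (S ⧸ 𝔟) N).flip ξ).toAddMonoidHom.comp
      (Ideal.Quotient.mk 𝔟).toAddMonoidHom
  change g s = 0
  obtain ⟨c, hc, b, hb, rfl⟩ := Submodule.mem_sup.mp hs
  have hgb : g b = 0 := by
    change (Ideal.Quotient.mk 𝔟 b) ⊗ₜ[R] ξ = 0
    rw [Ideal.Quotient.eq_zero_iff_mem.mpr hb, TensorProduct.zero_tmul]
  rw [map_add, hgb, add_zero]
  rw [← one_mul c]
  refine Submodule.span_induction (p := fun c _ => ∀ t : S, g (t * c) = 0) ?_ ?_ ?_ ?_ hc 1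
  · rintro _ ⟨a, ha, rfl⟩ t
    change (Ideal.Quotient.mk 𝔟 (t * algebraMap R S a)) ⊗ₜ[R] ξ = 0
    have : Ideal.Quotient.mk 𝔟 (t * algebraMap R S a) = a • Ideal.Quotient.mk 𝔟 t := by
      rw [mul_comm, map_mul, Algebra.smul_def]; rfl
    rw [this, TensorProduct.smul_tmul, hξ a ha, TensorProduct.tmul_zero]
  · simp
  · intro x y _ _ hx hy t
    rw [mul_add, map_add, hx, hy, add_zero]
  · intro r x _ hx t
    rw [smul_eq_mul, ← mul_assoc]
    exact hx _

/-- By flatness the annihilator of 1 ⊗ ξ in S/𝔟 is extended from that of ξ, which is a proper ideal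
of R. -/
theorem mem_of_mk_tmul_eq_zero (𝔟 : Ideal S) [Module.Flat R (S ⧸ 𝔟)] {N : Type w}
    [AddCommGroup N] [Module R N] {ξ : N} (hξ : ξ ≠ 0) {s : S}
    (hs : (Ideal.Quotient.mk 𝔟 s) ⊗ₜ[R] ξ = 0) :
    s ∈ (maximalIdeal R).map (algebraMap R S) ⊔ 𝔟 := by
  let f := LinearMap.toSpanSingleton R N ξ
  have hex := Module.Flat.lTensor_exact (S ⧸ 𝔟) (LinearMap.exact_subtype_ker_map f)
  obtain ⟨z, hz⟩ := (hex ((Ideal.Quotient.mk 𝔟 s) ⊗ₜ[R] (1 : R))).mp (by simpa [f] using hs)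
  have key : ∀ z : (S ⧸ 𝔟) ⊗[R] LinearMap.ker f, ∃ c ∈ (maximalIdeal R).map (algebraMap R S),
      TensorProduct.rid R (S ⧸ 𝔟) ((LinearMap.ker f).subtype.lTensor (S ⧸ 𝔟) z) =
        Ideal.Quotient.mk 𝔟 c := by
    intro z
    induction z with
    | zero => exact ⟨0, zero_mem _, by simp⟩
    | add x y hx hy =>
      obtain ⟨c, hc, h1⟩ := hx
      obtain ⟨d, hd, h2⟩ := hy
      exact ⟨c + d, add_mem hc hd, by rw [map_add, map_add, h1, h2, map_add]⟩
    | tmul t a =>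
      obtain ⟨t, rfl⟩ := Ideal.Quotient.mk_surjective t
      refine ⟨algebraMap R S a * t, Ideal.mul_mem_right _ _ (Ideal.mem_map_of_mem _ ?_), ?_⟩
      · rw [IsLocalRing.mem_maximalIdeal, mem_nonunits_iff]
        intro hu
        have h0 : (a : R) • ξ = 0 := a.2
        exact hξ ((hu.smul_eq_zero).mp h0)
      · rw [LinearMap.lTensor_tmul, TensorProduct.rid_tmul, map_mul, Algebra.smul_def]
        rfl
  obtain ⟨c, hc, h⟩ := key z
  rw [hz, TensorProduct.rid_tmul, one_smul, Ideal.Quotient.eq] at h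
  rw [← sub_add_cancel s c]
  exact add_mem (Ideal.mem_sup_right h) (Ideal.mem_sup_left hc)

/-- The socle of N is the kernel of N → N^n given by generators of m, so R → N → N^n, with 1 ↦ u
first, is exact; flat base change keeps it exact. -/
theorem exists_eq_mk_tmul [IsNoetherianRing R] (𝔟 : Ideal S) [Module.Flat R (S ⧸ 𝔟)] {N : Type w}
    [AddCommGroup N] [Module R N] {u : N} (hu : IsSocleGenerator R u) {x : (S ⧸ 𝔟) ⊗[R] N}
    (hx : ∀ a ∈ maximalIdeal R, a • x = 0) : ∃ s : S, x = (Ideal.Quotient.mk 𝔟 s) ⊗ₜ[R] u := by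
  obtain ⟨n, r, hr⟩ := Submodule.fg_iff_exists_fin_generating_family.mp
    (IsNoetherian.noetherian (maximalIdeal R))
  let g : N →ₗ[R] (Fin n → N) := LinearMap.pi fun i => r i • LinearMap.id
  have hg : Function.Exact (LinearMap.toSpanSingleton R N u) g := by
    intro y
    constructor
    · intro hy
      have hann : maximalIdeal R ≤ LinearMap.ker (LinearMap.toSpanSingleton R N y) := by
        rw [← hr, Submodule.span_le]
        rintro _ ⟨i, rfl⟩
        exact congrFun hy i
      obtain ⟨c, hc⟩ := hu.exists_smul_eq y fun a ha => hann ha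
      exact ⟨c, hc.symm⟩
    · rintro ⟨c, rfl⟩
      ext i
      have : r i • u = 0 := hu.smul_eq_zero _ (by rw [← hr]; exact Submodule.subset_span ⟨i, rfl⟩)
      simp [g, this]
  have hex := Module.Flat.lTensor_exact (S ⧸ 𝔟) hg
  have hzero : g.lTensor (S ⧸ 𝔟) x = 0 := by
    have hg' : g = ∑ i, (LinearMap.single R (fun _ : Fin n => N) i).comp (r i • LinearMap.id) := by
      ext y j
      simp [g, Finset.sum_apply, Pi.single_apply]
    rw [hg', ← LinearMap.coe_lTensorHom, map_sum, LinearMap.sum_apply]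
    refine Finset.sum_eq_zero fun i _ => ?_
    rw [LinearMap.coe_lTensorHom, LinearMap.lTensor_comp, LinearMap.comp_apply,
      LinearMap.lTensor_smul, LinearMap.smul_apply, LinearMap.lTensor_id, LinearMap.id_apply,
      hx _ (by rw [← hr]; exact Submodule.subset_span ⟨i, rfl⟩), map_zero]
  obtain ⟨y, hy⟩ := (hex x).mp hzero
  obtain ⟨s, hs⟩ := Ideal.Quotient.mk_surjective (TensorProduct.rid R (S ⧸ 𝔟) y)
  refine ⟨s, ?_⟩
  have hy' : y = (Ideal.Quotient.mk 𝔟 s) ⊗ₜ[R] (1 : R) := by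
    rw [hs, ← TensorProduct.rid_symm_apply, LinearEquiv.symm_apply_apply]
  rw [← hy, hy', LinearMap.lTensor_tmul, LinearMap.toSpanSingleton_apply_one]

/-- The class of `w` generates the socle of the cyclic module `A ⧸ I`, which is simple. -/
structure GeneratesSocleMod {A : Type u} [CommRing A] [IsLocalRing A] (I : Ideal A) (w : A) :
    Prop where
  mul_mem : ∀ a ∈ maximalIdeal A, a * w ∈ I
  notMem : w ∉ I
  exists_sub_mem : ∀ s : A, (∀ a ∈ maximalIdeal A, a * s ∈ I) → ∃ r : A, s - r * w ∈ I

/-- Base change of a simple socle along a flat map whose closed fiber has a simple socle. -/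
theorem IsSocleGenerator.mk_tmul [IsNoetherianRing R] [IsLocalRing S]
    [IsLocalHom (algebraMap R S)] {𝔟 : Ideal S} [Module.Flat R (S ⧸ 𝔟)] {N : Type w}
    [AddCommGroup N] [Module R N] {u : N} (hu : IsSocleGenerator R u) {w : S}
    (hw : GeneratesSocleMod ((maximalIdeal R).map (algebraMap R S) ⊔ 𝔟) w) :
    IsSocleGenerator S ((Ideal.Quotient.mk 𝔟 w) ⊗ₜ[R] u) where
  smul_eq_zero a ha := by
    have h := mk_tmul_eq_zero 𝔟 hu.smul_eq_zero (hw.mul_mem a ha)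
    rw [map_mul] at h
    exact h
  ne_zero h := hw.notMem (mem_of_mk_tmul_eq_zero 𝔟 hu.ne_zero h)
  exists_smul_eq x hx := by
    obtain ⟨s, rfl⟩ := exists_eq_mk_tmul 𝔟 hu (x := x) fun a ha => by
      rw [← algebraMap_smul S a x]
      exact hx _ (map_maximalIdeal_le (Ideal.mem_map_of_mem _ ha))
    obtain ⟨r, hr⟩ := hw.exists_sub_mem s fun a ha => by
      have h := hx a ha
      refine mem_of_mk_tmul_eq_zero 𝔟 hu.ne_zero ?_
      rw [map_mul]
      exact h
    refine ⟨r, ?_⟩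
    have h := mk_tmul_eq_zero 𝔟 hu.smul_eq_zero hr
    rw [map_sub, TensorProduct.sub_tmul, sub_eq_zero, map_mul] at h
    exact h

end FlatTensor

/-! ### Injective modules with simple socle and their torsion submodules. -/

section InjectiveHull

variable {R : Type u} [CommRing R]

theorem exists_injective_embedding (M : Type u) [AddCommGroup M] [Module R M] :
    ∃ (J : Type u) (_ : AddCommGroup J) (_ : Module R J) (i : M →ₗ[R] J),
      Module.Injective R J ∧ Function.Injective i := by
  let J : ModuleCat.{u} R := CategoryTheory.Injective.under (ModuleCat.of R M)
  let ι : ModuleCat.of R M ⟶ J := CategoryTheory.Injective.ι (ModuleCat.of R M)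
  have hJ : CategoryTheory.Injective (ModuleCat.of R J) :=
    inferInstanceAs (CategoryTheory.Injective J)
  exact ⟨J, inferInstance, inferInstance, ι.hom, Module.injective_module_of_injective_object R J,
    (ModuleCat.mono_iff_injective ι).mp inferInstance⟩

/-- A submodule of an injective module which is maximal among the submodules that are essential
over `v` is injective. -/
theorem injective_of_maximal_essential {J : Type u} [AddCommGroup J] [Module R J]
    [Module.Injective R J] {v : J} {E : Submodule R J}
    (hE : Maximal (fun E : Submodule R J => v ∈ E ∧ ∀ x ∈ E, x ≠ 0 → ∃ r : R, r • x = v) E)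
    (hv : v ≠ 0) : Module.Injective R E := by
  -- X is maximal avoiding v. Essentiality makes E meet X trivially, so E embeds in J/X, and
  -- injectivity of J extends the inclusion of E to J/X.
  obtain ⟨X, -, hX⟩ := zorn_le_nonempty₀ {X : Submodule R J | v ∉ X} (by
    intro c hc hchain y hy
    refine ⟨sSup c, fun h => ?_, fun z hz => le_sSup hz⟩
    obtain ⟨Z, hZ, hvZ⟩ := (Submodule.mem_sSup_of_directed ⟨y, hy⟩ hchain.directedOn).mp h
    exact hc hZ hvZ) ⊥ (by simpa using hv)
  have hXv : v ∉ X := hX.prop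
  have hX' : ∀ y ∉ X, ∃ r : R, v - r • y ∈ X := by
    intro y hy
    by_contra! hcon
    have hlt : X < X ⊔ (R ∙ y) := by
      refine lt_of_le_of_ne le_sup_left fun h => hy ?_
      rw [h]
      exact Submodule.mem_sup_right (Submodule.mem_span_singleton_self y)
    refine hX.not_prop_of_gt hlt fun h => ?_
    obtain ⟨x, hx, z, hz, h⟩ := Submodule.mem_sup.mp h
    obtain ⟨r, rfl⟩ := Submodule.mem_span_singleton.mp hz
    exact hcon r (by rw [← h, add_sub_cancel_right]; exact hx)
  have hinj : Function.Injective (X.mkQ.comp E.subtype) := by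
    rw [← LinearMap.ker_eq_bot, LinearMap.ker_eq_bot']
    rintro ⟨x, hxE⟩ hx
    have hxX : x ∈ X := (Submodule.Quotient.mk_eq_zero X).mp hx
    by_contra hne
    obtain ⟨r, hr⟩ := hE.prop.2 x hxE fun h => hne (Subtype.ext h)
    exact hXv (hr ▸ X.smul_mem r hxX)
  obtain ⟨g, hg⟩ := Module.Injective.out (R := R) (X.mkQ.comp E.subtype) hinj E.subtype
  let G : J →ₗ[R] J := g.comp X.mkQ
  have hG : ∀ x ∈ E, G x = x := fun x hx => hg ⟨x, hx⟩
  have hGv : G v = v := hG v hE.prop.1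
  have hGX : ∀ x ∈ X, G x = 0 := fun x hx => by
    have : X.mkQ x = 0 := (Submodule.Quotient.mk_eq_zero X).mpr hx
    rw [LinearMap.comp_apply, this, map_zero]
  -- The range of G is again essential over v: if G y ≠ 0 then y ∉ X, so v - r y ∈ X for some r, and
  -- r G y = G v = v. Maximality makes G a retraction of J onto E.
  have hrange : LinearMap.range G ≤ E := by
    refine hE.le_of_ge ⟨⟨v, hGv⟩, ?_⟩ fun x hx => ⟨x, hG x hx⟩
    rintro _ ⟨y, rfl⟩ hne
    obtain ⟨r, hr⟩ := hX' y fun hy => hne (hGX y hy)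
    refine ⟨r, ?_⟩
    have h := hGX _ hr
    rw [map_sub, hGv, map_smul, sub_eq_zero] at h
    exact h.symm
  let ρ : J →ₗ[R] E := G.codRestrict E fun x => hrange ⟨x, rfl⟩
  constructor
  intro A B _ _ _ _ f hf h
  obtain ⟨k, hk⟩ := Module.Injective.out (R := R) f hf (E.subtype.comp h)
  refine ⟨ρ.comp k, fun a => Subtype.ext ?_⟩
  have : G (k (f a)) = h a := by
    rw [hk]
    exact hG _ (h a).2
  exact this

variable [IsLocalRing R]

variable (R) in
/-- A local ring has an injective module with simple socle. -/
theorem exists_injective_isSocleGenerator :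
    ∃ (E : Type u) (_ : AddCommGroup E) (_ : Module R E) (u : E),
      Module.Injective R E ∧ IsSocleGenerator R u := by
  obtain ⟨J, _, _, i, hJ, hi⟩ := exists_injective_embedding (R := R) (R ⧸ maximalIdeal R)
  have hmem : ∀ a ∈ maximalIdeal R, a • i 1 = 0 := by
    intro a ha
    rw [← map_smul, Algebra.smul_def, mul_one]
    have : algebraMap R (R ⧸ maximalIdeal R) a = 0 := Ideal.Quotient.eq_zero_iff_mem.mpr ha
    rw [this, map_zero]
  have hne : i 1 ≠ 0 := by
    rw [Ne, map_eq_zero_iff i hi]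
    exact one_ne_zero
  have hunit : ∀ r : R, r • i 1 ≠ 0 → IsUnit r := by
    intro r hr
    by_contra h
    exact hr (hmem r (by simpa using h))
  obtain ⟨E, -, hE⟩ := zorn_le_nonempty₀
    {E : Submodule R J | i 1 ∈ E ∧ ∀ x ∈ E, x ≠ 0 → ∃ r : R, r • x = i 1} (by
      intro c hc hchain y hy
      refine ⟨sSup c, ⟨(le_sSup hy) (hc hy).1, fun x hx hx0 => ?_⟩, fun z hz => le_sSup hz⟩
      obtain ⟨Z, hZ, hxZ⟩ := (Submodule.mem_sSup_of_directed ⟨y, hy⟩ hchain.directedOn).mp hx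
      exact (hc hZ).2 x hxZ hx0) (R ∙ i 1) (by
      refine ⟨Submodule.mem_span_singleton_self _, fun x hx hx0 => ?_⟩
      obtain ⟨r, rfl⟩ := Submodule.mem_span_singleton.mp hx
      obtain ⟨s, rfl⟩ := hunit r hx0
      exact ⟨(s⁻¹ : Rˣ), by rw [smul_smul]; simp⟩)
  refine ⟨E, inferInstance, inferInstance, ⟨i 1, hE.prop.1⟩,
    injective_of_maximal_essential hE hne, ⟨fun a ha => Subtype.ext (hmem a ha),
      fun h => hne (congrArg Subtype.val h), ?_⟩⟩
  rintro ⟨x, hx⟩ hmx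
  by_cases hx0 : x = 0
  · exact ⟨0, by ext; simp [hx0]⟩
  obtain ⟨r, hr⟩ := hE.prop.2 x hx hx0
  have hru : IsUnit r := by
    by_contra h
    refine hne ?_
    rw [← hr]
    exact congrArg Subtype.val (hmx r (by simpa using h))
  obtain ⟨s, rfl⟩ := hru
  refine ⟨(s⁻¹ : Rˣ), Subtype.ext ?_⟩
  change x = ((s⁻¹ : Rˣ) : R) • i 1
  rw [← hr, smul_smul]
  simp

variable {E : Type u} [AddCommGroup E] [Module R E] {u : E}

/-- Injectivity makes Hom(-, E) exact, so lengths add; each simple factor contributes at least one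
because it maps onto the socle. -/
theorem IsSocleGenerator.length_le_length_hom [Module.Injective R E] (hu : IsSocleGenerator R u)
    {D : Type u} [AddCommGroup D] [Module R D] (hD : IsFiniteLength R D) :
    Module.length R D ≤ Module.length R (D →ₗ[R] E) := by
  induction hD with
  | of_subsingleton =>
    rw [Module.length_eq_zero]
    exact zero_le
  | @of_simple_quotient M _ _ N hs _ ih =>
    rw [Module.length_eq_add_of_exact N.subtype N.mkQ N.injective_subtype N.mkQ_surjective
      (LinearMap.exact_subtype_mkQ N), add_comm, Module.length_eq_one R (M ⧸ N),
      Module.length_eq_add_of_exact (LinearMap.lcomp R E N.mkQ) (LinearMap.lcomp R E N.subtype)]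
    · refine add_le_add ?_ ih
      rw [Order.one_le_iff_ne_zero, ← pos_iff_ne_zero, Module.length_pos_iff]
      obtain ⟨I, hI, ⟨e⟩⟩ := isSimpleModule_iff_quot_maximal.mp hs
      obtain rfl := IsLocalRing.eq_maximalIdeal hI
      refine ⟨(quotToSpan u hu.smul_eq_zero).comp e.toLinearMap, 0, fun h => hu.ne_zero ?_⟩
      simpa using LinearMap.congr_fun h (e.symm 1)
    · intro f g hfg
      ext x
      exact LinearMap.congr_fun hfg x
    · intro f
      obtain ⟨g, hg⟩ := Module.Injective.out (R := R) N.subtype N.injective_subtype f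
      exact ⟨g, LinearMap.ext hg⟩
    · intro f
      constructor
      · intro hf
        exact ⟨N.liftQ f fun x hx => LinearMap.congr_fun hf ⟨x, hx⟩, by ext; rfl⟩
      · rintro ⟨g, rfl⟩
        ext x
        have : N.mkQ (N.subtype x) = 0 := (Submodule.Quotient.mk_eq_zero N).mpr x.2
        simp only [LinearMap.lcomp_apply, this, map_zero, LinearMap.zero_apply]

/-- The `I`-torsion of an injective module with simple socle is a dualizing module of `R ⧸ I`. -/
theorem IsSocleGenerator.length_torsionBySet [Module.Injective R E] (hu : IsSocleGenerator R u)
    {I : Ideal R} (hI : Module.length R (R ⧸ I) ≠ ⊤) :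
    Module.length R (Submodule.torsionBySet R E I) = Module.length R (R ⧸ I) := by
  have hfin := Module.length_ne_top_iff.mp hI
  refine le_antisymm (le_trans ?_ (hu.length_hom_le hfin))
    ((hu.length_le_length_hom hfin).trans ?_)
  · let g : Submodule.torsionBySet R E I →ₗ[R] ((R ⧸ I) →ₗ[R] E) :=
      { toFun := fun x => quotToSpan (x : E) fun a ha =>
          (Submodule.mem_torsionBySet_iff _ _).mp x.2 ⟨a, ha⟩
        map_add' := fun x y => by ext; simp
        map_smul' := fun r x => by ext; simp }
    refine Module.length_le_of_injective g fun x y h => Subtype.ext ?_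
    simpa [g] using LinearMap.congr_fun h 1
  · let g : ((R ⧸ I) →ₗ[R] E) →ₗ[R] Submodule.torsionBySet R E I :=
      (LinearMap.applyₗ (1 : R ⧸ I)).codRestrict _ fun f => by
        rw [Submodule.mem_torsionBySet_iff]
        rintro ⟨a, ha⟩
        change a • f 1 = 0
        have : a • (1 : R ⧸ I) = 0 := by
          rw [Algebra.smul_def, mul_one]
          exact Ideal.Quotient.eq_zero_iff_mem.mpr ha
        rw [← map_smul, this, map_zero]
    refine Module.length_le_of_injective g fun f f' h => ?_
    ext
    exact congrArg Subtype.val h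

theorem IsSocleGenerator.torsionBySet (hu : IsSocleGenerator R u) {I : Ideal R}
    (hmem : u ∈ Submodule.torsionBySet R E I) :
    IsSocleGenerator R (⟨u, hmem⟩ : Submodule.torsionBySet R E I) where
  smul_eq_zero a ha := Subtype.ext (hu.smul_eq_zero a ha)
  ne_zero h := hu.ne_zero (congrArg Subtype.val h)
  exists_smul_eq x hx := by
    obtain ⟨r, hr⟩ := hu.exists_smul_eq x fun a ha => congrArg Subtype.val (hx a ha)
    exact ⟨r, Subtype.ext hr⟩

end InjectiveHull

/-! ### Systems of parameters, and F-rational local rings as domains. -/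

section FRational

variable {A : Type u} [CommRing A]

theorem isNilpotent_of_forall_mem_minimalPrimes {x : A} (h : ∀ P ∈ minimalPrimes A, x ∈ P) :
    IsNilpotent x := by
  rw [← mem_nilradical, nilradical, ← Ideal.sInf_minimalPrimes]
  exact (Submodule.mem_sInf).mpr h

variable [IsNoetherianRing A]

theorem exists_notMem_mul_eq_zero_of_mem_minimalPrimes [IsReduced A] {P : Ideal A}
    (hP : P ∈ minimalPrimes A) {c : A} (hc : c ∈ P) : ∃ y ∉ P, c * y = 0 := by
  classical
  have hfin := minimalPrimes.finite_of_isNoetherianRing A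
  have := hP.1.1
  have hnot : ¬ (∏ Q ∈ hfin.toFinset.erase P, Q) ≤ P := by
    rw [this.prod_le]
    rintro ⟨Q, hQ, hle⟩
    obtain ⟨hne, hQ⟩ := Finset.mem_erase.mp hQ
    rw [Set.Finite.mem_toFinset] at hQ
    exact hne (le_antisymm hle (hP.2 hQ.1 hle))
  obtain ⟨y, hy, hyP⟩ := Set.not_subset.mp hnot
  refine ⟨y, hyP, (isNilpotent_of_forall_mem_minimalPrimes fun Q hQ => ?_).eq_zero⟩
  by_cases hQP : Q = P
  · exact hQP ▸ P.mul_mem_right _ hc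
  · refine Q.mul_mem_left _ (Ideal.prod_le_inf.trans (Finset.inf_le ?_) hy)
    exact Finset.mem_erase.mpr ⟨hQP, hfin.mem_toFinset.mpr hQ⟩

/-- Prime avoidance: choose b in the annihilator of c outside the minimal primes containing c; it
lies in all the others, since c b = 0. -/
theorem exists_mul_eq_zero_add_notMem_minimalPrimes [IsReduced A] (c : A) :
    ∃ b : A, c * b = 0 ∧ ∀ P ∈ minimalPrimes A, c + b ∉ P := by
  have hfin := (minimalPrimes.finite_of_isNoetherianRing A).subset
    (Set.sep_subset (minimalPrimes A) fun P => c ∈ P)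
  have hnot : ¬ ((Ideal.span {c}).annihilator : Set A) ⊆
      ⋃ P ∈ {P ∈ minimalPrimes A | c ∈ P}, (P : Set A) := by
    rw [Ideal.subset_union_prime_finite hfin (f := fun P => P) ⊥ ⊥ fun P hP _ _ => hP.1.1.1]
    rintro ⟨P, hP, hle⟩
    obtain ⟨y, hy, hcy⟩ := exists_notMem_mul_eq_zero_of_mem_minimalPrimes hP.1 hP.2
    refine hy (hle ?_)
    rw [Ideal.span, Submodule.mem_annihilator_span_singleton, smul_eq_mul, mul_comm, hcy]
  obtain ⟨b, hb, hbP⟩ := Set.not_subset.mp hnot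
  have hcb : c * b = 0 := by
    rw [SetLike.mem_coe, Ideal.span, Submodule.mem_annihilator_span_singleton, smul_eq_mul,
      mul_comm] at hb
    exact hb
  refine ⟨b, hcb, fun P hP hmem => ?_⟩
  have := hP.1.1
  by_cases hc : c ∈ P
  · refine hbP (Set.mem_biUnion (⟨hP, hc⟩ : P ∈ {P ∈ minimalPrimes A | c ∈ P}) ?_)
    exact (P.add_mem_iff_right hc).mp hmem
  · have hb : b ∈ P := (this.mem_or_mem (hcb ▸ P.zero_mem : c * b ∈ P)).resolve_left hc
    exact hc ((P.add_mem_iff_left hb).mp hmem)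

variable [IsLocalRing A]

variable (A) in
theorem exists_isSOP : ∃ z : List A, IsSOP z := by
  obtain ⟨s, hs, hcard⟩ :=
    (maximalIdeal A).exists_finset_card_eq_height_of_isNoetherianRing
  refine ⟨s.toList, ?_, ?_⟩
  · rw [Finset.length_toList, ← IsLocalRing.maximalIdeal_height_eq_ringKrullDim, ← hcard]
    rfl
  · have hspan : Ideal.ofList s.toList = Ideal.span (s : Set A) := by
      simp [Ideal.ofList]
    rw [hspan]
    refine le_antisymm ((maximalIdeal.isMaximal A).isPrime.radical_le_iff.mpr hs.1.2) ?_
    rw [← Ideal.sInf_minimalPrimes]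
    refine le_sInf fun Q hQ => ?_
    exact hs.2 hQ.1 (IsLocalRing.le_maximalIdeal hQ.1.1.ne_top)

theorem ringKrullDim_le_length {z : List A} (hz : (Ideal.ofList z).radical = maximalIdeal A) :
    ringKrullDim A ≤ z.length := by
  classical
  rw [← IsLocalRing.maximalIdeal_height_eq_ringKrullDim]
  have hspan : Ideal.ofList z = Ideal.span (z.toFinset : Set A) := by
    simp [Ideal.ofList]
  have hmin : maximalIdeal A ∈ (Ideal.span (z.toFinset : Set A)).minimalPrimes := by
    rw [← hspan]
    refine ⟨⟨(maximalIdeal.isMaximal A).isPrime, hz ▸ Ideal.le_radical⟩, fun Q hQ _ => ?_⟩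
    rw [← hz]
    exact hQ.1.radical_le_iff.mpr hQ.2
  have h1 := Ideal.height_le_card_of_mem_minimalPrimes_span_finset hmin
  have h2 : (z.toFinset.card : ℕ∞) ≤ z.length := by exact_mod_cast z.toFinset_card_le
  exact WithBot.coe_le_coe.mpr (h1.trans h2)

/-- A nonzerodivisor is a parameter. -/
theorem exists_isSOP_cons {x : A} (hx : x ∈ nonZeroDivisors A) (hxm : x ∈ maximalIdeal A) :
    ∃ z : List A, IsSOP (x :: z) := by
  have : Nontrivial (A ⧸ Ideal.span {x}) := Ideal.Quotient.nontrivial_iff.mpr fun h =>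
    (maximalIdeal.isMaximal A).ne_top (top_le_iff.mp
      (h ▸ (Ideal.span_singleton_le_iff_mem _).mpr hxm))
  have : IsLocalRing (A ⧸ Ideal.span {x}) :=
    IsLocalRing.of_surjective' (Ideal.Quotient.mk _) Ideal.Quotient.mk_surjective
  obtain ⟨z', hz1, hz2⟩ := exists_isSOP (A ⧸ Ideal.span {x})
  obtain ⟨z, rfl⟩ := (List.map_surjective_iff.mpr
    (Ideal.Quotient.mk_surjective (I := Ideal.span {x}))) z'
  rw [List.length_map] at hz1
  have hrad : (Ideal.ofList (x :: z)).radical = maximalIdeal A := by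
    have hcomap : Ideal.ofList (x :: z) =
        (Ideal.ofList (z.map (Ideal.Quotient.mk (Ideal.span {x})))).comap
          (Ideal.Quotient.mk (Ideal.span {x})) := by
      rw [← Ideal.map_ofList, Ideal.comap_map_of_surjective _ Ideal.Quotient.mk_surjective,
        ← RingHom.ker_eq_comap_bot, Ideal.mk_ker, Ideal.ofList_cons, sup_comm]
    rw [hcomap, ← Ideal.comap_radical, hz2]
    exact ((IsLocalRing.local_hom_TFAE (Ideal.Quotient.mk (Ideal.span {x}))).out 0 4).mp
      (IsLocalHom.of_surjective _ Ideal.Quotient.mk_surjective)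
  -- Krull's height theorem bounds the dimension by the length; the reverse holds since killing a
  -- nonzerodivisor lowers the dimension by at least one.
  refine ⟨z, le_antisymm ?_ (ringKrullDim_le_length hrad), hrad⟩
  rw [List.length_cons]
  refine le_trans ?_ (ringKrullDim_quotient_succ_le_of_nonZeroDivisor hx)
  rw [← hz1]
  simp

theorem FRational.isReduced {p : ℕ} [Fact p.Prime] (h : FRational p A) : IsReduced A := by
  refine ⟨fun x ⟨n, hn⟩ => ?_⟩
  -- The zero ideal is a parameter ideal, generated by the empty part of z, and a nilpotent lies in
  -- its tight closure with multiplier 1.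
  obtain ⟨z, hz⟩ := exists_isSOP A
  have h0 := h (Ideal.ofList []) ⟨[], z, hz, rfl⟩ x
    ⟨1, fun P hP h1 => hP.1.1.ne_top ((Ideal.eq_top_iff_one _).mpr h1), n, fun e he => by
      have hle : n ≤ p ^ e := he.trans (Nat.lt_pow_self (Fact.out : p.Prime).one_lt).le
      rw [pow_eq_zero_of_le hle hn, mul_zero]
      exact zero_mem _⟩
  simpa using h0

/-- An `F`-rational local ring is a domain, so nonzero elements avoid all minimal primes. -/
theorem FRational.notMem_minimalPrimes {p : ℕ} [Fact p.Prime] (h : FRational p A) {c : A}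
    (hc : c ≠ 0) : ∀ P ∈ minimalPrimes A, c ∉ P := by
  intro P hP hcP
  have := h.isReduced
  obtain ⟨b, hcb, hmin⟩ := exists_mul_eq_zero_add_notMem_minimalPrimes c
  have hb : b ≠ 0 := by
    rintro rfl
    exact hmin P hP (by simpa using hcP)
  have hcm : c ∈ maximalIdeal A := IsLocalRing.le_maximalIdeal hP.1.1.ne_top hcP
  have hbm : b ∈ maximalIdeal A := by
    rw [IsLocalRing.mem_maximalIdeal, mem_nonunits_iff]
    exact fun hu => hc ((hu.mul_left_eq_zero).mp hcb)
  have hreg : c + b ∈ nonZeroDivisors A := by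
    rw [mem_nonZeroDivisors_iff_right]
    intro y hy
    refine (isNilpotent_of_forall_mem_minimalPrimes fun Q hQ => ?_).eq_zero
    have := hQ.1.1
    exact (this.mem_or_mem (hy ▸ Q.zero_mem : y * (c + b) ∈ Q)).resolve_right (hmin Q hQ)
  obtain ⟨z, hz⟩ := exists_isSOP_cons hreg (add_mem hcm hbm)
  -- Both sides equal c^(n+2) because c b = 0. Taking n + 1 = q puts c in the tight closure of (c +
  -- b), with multiplier c + b.
  have hpow : ∀ n : ℕ, (c + b) * c ^ (n + 1) = c * (c + b) ^ (n + 1) := by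
    intro n
    have h1 : ∀ m : ℕ, c * (c + b) ^ m = c ^ (m + 1) := by
      intro m
      induction m with
      | zero => simp
      | succ m ih => rw [pow_succ, ← mul_assoc, ih]; linear_combination c ^ m * hcb
    rw [h1]
    linear_combination c ^ n * hcb
  have hmem := h (Ideal.ofList [c + b]) ⟨[c + b], z, hz, rfl⟩ c
    ⟨c + b, hmin, 0, fun e _ => by
      obtain ⟨n, hn⟩ := Nat.exists_eq_succ_of_ne_zero
        (pow_pos (Fact.out : p.Prime).pos e).ne'
      rw [hn, Nat.succ_eq_add_one, hpow]
      refine Ideal.mul_mem_left _ _ (Ideal.subset_span ⟨c + b, ?_, rfl⟩)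
      simp⟩
  rw [Ideal.ofList_singleton, Ideal.mem_span_singleton'] at hmem
  obtain ⟨d, hd⟩ := hmem
  -- From c = d (c + b) and c b = 0 follow d b² = 0 and (1 - d) c² = 0, so b or c vanishes.
  rcases IsLocalRing.isUnit_or_isUnit_one_sub_self d with hu | hu
  · have h2 : d * (b * b) = 0 := by linear_combination b * hd + (1 - d) * hcb
    exact hb (IsReduced.eq_zero b ⟨2, by rw [sq]; exact (hu.mul_right_eq_zero).mp h2⟩)
  · have h2 : (1 - d) * (c * c) = 0 := by linear_combination - c * hd + d * hcb
    exact hc (IsReduced.eq_zero c ⟨2, by rw [sq]; exact (hu.mul_right_eq_zero).mp h2⟩)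

end FRational

section

open scoped TensorProduct

/-! ### Nonvanishing of tensors through a commutative square of rings. -/

section Nonvanishing

variable {R R' : Type u} {S S' : Type v} [CommRing R] [CommRing R'] [CommRing S] [CommRing S']
  [Algebra R S] [Algebra R R'] [Algebra S S'] [Algebra R' S']

/-- The map `S' ⊗ (S ⧸ 𝔟 ⊗ ω) → S' ⧸ 𝔟' ⊗ (R' ⊗ ω)` given by a commutative square of rings. -/
theorem exists_baseChange_addHom
    (hcomm : ∀ r : R, algebraMap S S' (algebraMap R S r) = algebraMap R' S' (algebraMap R R' r))
    {𝔟 : Ideal S} {𝔟' : Ideal S'} (h𝔟 : 𝔟 ≤ 𝔟'.comap (algebraMap S S')) (ω : Type w)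
    [AddCommGroup ω] [Module R ω] :
    ∃ F : (S' ⊗[S] ((S ⧸ 𝔟) ⊗[R] ω)) →+ ((S' ⧸ 𝔟') ⊗[R'] (R' ⊗[R] ω)),
      ∀ (y : S') (s : S) (x : ω), F (y ⊗ₜ[S] ((Ideal.Quotient.mk 𝔟 s) ⊗ₜ[R] x)) =
        (Ideal.Quotient.mk 𝔟' (y * algebraMap S S' s)) ⊗ₜ[R'] ((1 : R') ⊗ₜ[R] x) := by
  let T : (S' ⧸ 𝔟') →+ ω →+ ((S' ⧸ 𝔟') ⊗[R'] (R' ⊗[R] ω)) :=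
    AddMonoidHom.mk' (fun y => AddMonoidHom.mk' (fun x => y ⊗ₜ[R'] ((1 : R') ⊗ₜ[R] x))
      (fun a b => by rw [TensorProduct.tmul_add, TensorProduct.tmul_add]))
      (fun a b => by ext x; simp [TensorProduct.add_tmul])
  let ψ : (S ⧸ 𝔟) →+* (S' ⧸ 𝔟') := Ideal.quotientMap 𝔟' (algebraMap S S') h𝔟
  let φ : S' → ((S ⧸ 𝔟) ⊗[R] ω) →+ ((S' ⧸ 𝔟') ⊗[R'] (R' ⊗[R] ω)) := fun y =>
    TensorProduct.liftAddHom (R := R)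
      (T.comp ((AddMonoidHom.mulLeft (Ideal.Quotient.mk 𝔟' y)).comp ψ.toAddMonoidHom)) (by
        intro r s x
        obtain ⟨s, rfl⟩ := Ideal.Quotient.mk_surjective s
        have h1 : r • Ideal.Quotient.mk 𝔟 s = Ideal.Quotient.mk 𝔟 (algebraMap R S r * s) := by
          rw [map_mul, Algebra.smul_def]; rfl
        rw [h1]
        change (Ideal.Quotient.mk 𝔟' (y * algebraMap S S' (algebraMap R S r * s))) ⊗ₜ[R']
          ((1 : R') ⊗ₜ[R] x) = (Ideal.Quotient.mk 𝔟' (y * algebraMap S S' s)) ⊗ₜ[R']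
          ((1 : R') ⊗ₜ[R] (r • x))
        have h2 : Ideal.Quotient.mk 𝔟' (y * algebraMap S S' (algebraMap R S r * s)) =
            algebraMap R R' r • Ideal.Quotient.mk 𝔟' (y * algebraMap S S' s) := by
          rw [Algebra.smul_def]
          change _ = Ideal.Quotient.mk 𝔟' (algebraMap R' S' (algebraMap R R' r)) * _
          rw [← map_mul, map_mul (algebraMap S S'), hcomm, mul_left_comm]
        rw [h2, TensorProduct.smul_tmul, algebraMap_smul, ← TensorProduct.tmul_smul])
  have hφ : ∀ y s x, φ y ((Ideal.Quotient.mk 𝔟 s) ⊗ₜ[R] x) =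
      (Ideal.Quotient.mk 𝔟' (y * algebraMap S S' s)) ⊗ₜ[R'] ((1 : R') ⊗ₜ[R] x) :=
    fun y s x => rfl
  let Φ : S' →+ ((S ⧸ 𝔟) ⊗[R] ω) →+ ((S' ⧸ 𝔟') ⊗[R'] (R' ⊗[R] ω)) :=
    AddMonoidHom.mk' φ (fun a b => by
      ext t
      induction t with
      | zero => simp
      | add x y hx hy => rw [map_add, map_add, hx, hy]
      | tmul s x =>
        obtain ⟨s, rfl⟩ := Ideal.Quotient.mk_surjective s
        rw [AddMonoidHom.add_apply, hφ, hφ, hφ, add_mul, map_add, TensorProduct.add_tmul])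
  refine ⟨TensorProduct.liftAddHom (R := S) Φ ?_, fun y s x => rfl⟩
  intro a y t
  induction t with
  | zero => simp
  | add x y hx hy => rw [smul_add, map_add, map_add, hx, hy]
  | tmul s x =>
    obtain ⟨s, rfl⟩ := Ideal.Quotient.mk_surjective s
    have h1 : a • ((Ideal.Quotient.mk 𝔟 s) ⊗ₜ[R] x) = (Ideal.Quotient.mk 𝔟 (a * s)) ⊗ₜ[R] x := by
      rw [TensorProduct.smul_tmul', map_mul]; rfl
    rw [h1]
    change φ (a • y) _ = φ y _
    rw [hφ, hφ, Algebra.smul_def, map_mul (algebraMap S S')]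
    congr 2
    ring

theorem tmul_mk_tmul_ne_zero [IsLocalRing R']
    (hcomm : ∀ r : R, algebraMap S S' (algebraMap R S r) = algebraMap R' S' (algebraMap R R' r))
    {𝔟 : Ideal S} {𝔟' : Ideal S'} (h𝔟 : 𝔟 ≤ 𝔟'.comap (algebraMap S S'))
    [Module.Flat R' (S' ⧸ 𝔟')] {ω : Type w} [AddCommGroup ω] [Module R ω] {u : ω} {d : R'}
    (hd : d ⊗ₜ[R] u ≠ 0) {c : S'} {s : S}
    (hc : c * algebraMap S S' s ∉ (maximalIdeal R').map (algebraMap R' S') ⊔ 𝔟') :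
    (algebraMap R' S' d * c) ⊗ₜ[S] ((Ideal.Quotient.mk 𝔟 s) ⊗ₜ[R] u) ≠ 0 := by
  obtain ⟨F, hF⟩ := exists_baseChange_addHom hcomm h𝔟 ω
  intro h0
  have h := hF (algebraMap R' S' d * c) s u
  rw [h0, map_zero] at h
  have h2 : Ideal.Quotient.mk 𝔟' (algebraMap R' S' d * c * algebraMap S S' s) =
      d • Ideal.Quotient.mk 𝔟' (c * algebraMap S S' s) := by
    rw [Algebra.smul_def, mul_assoc, map_mul]; rfl
  rw [h2, TensorProduct.smul_tmul, TensorProduct.smul_tmul', smul_eq_mul, mul_one] at h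
  exact hc (mem_of_mk_tmul_eq_zero 𝔟' hd h.symm)

end Nonvanishing

/-- When a power of the maximal ideal kills W, each nonzero y has a multiple that is a unit times u,
so injectivity of x ⊗ - need only be tested on u. -/
theorem IsSocleGenerator.eq_zero_of_tmul_eq_zero {A : Type u} [CommRing A] [IsLocalRing A]
    {W : Type v} [AddCommGroup W] [Module A W] {u : W} (hu : IsSocleGenerator A u) {k : ℕ}
    (hk : ∀ a ∈ maximalIdeal A ^ k, ∀ y : W, a • y = 0) {N : Type w} [AddCommGroup N] [Module A N]
    {x : N} (hx : x ⊗ₜ[A] u ≠ 0) {y : W} (hy : x ⊗ₜ[A] y = 0) : y = 0 := by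
  by_contra hne
  have key : ∀ k : ℕ, (∀ a ∈ maximalIdeal A ^ k, a • y = 0) →
      ∃ b : A, b • y ≠ 0 ∧ ∀ a ∈ maximalIdeal A, a • b • y = 0 := by
    intro k
    induction k with
    | zero => exact fun h => absurd (by simpa using h 1 (by simp)) hne
    | succ k ih =>
      intro h
      by_cases h' : ∀ a ∈ maximalIdeal A ^ k, a • y = 0
      · exact ih h'
      · push Not at h'
        obtain ⟨b, hb, hby⟩ := h'
        refine ⟨b, hby, fun a ha => ?_⟩
        rw [smul_smul]
        exact h _ (by rw [pow_succ']; exact Ideal.mul_mem_mul ha hb)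
  obtain ⟨b, hb, hmb⟩ := key k fun a ha => hk a ha y
  obtain ⟨r, hr⟩ := hu.exists_smul_eq _ hmb
  have hru : IsUnit r := by
    by_contra h
    exact hb (hr.trans (hu.smul_eq_zero r (by simpa using h)))
  obtain ⟨r, rfl⟩ := hru
  have huy : u = ((r⁻¹ : Aˣ) : A) • b • y := by
    rw [hr, smul_smul]; simp
  refine hx ?_
  rw [huy, TensorProduct.tmul_smul, TensorProduct.tmul_smul, hy, smul_zero, smul_zero]

/-! ### Socles modulo powers of a regular sequence. -/

section RegularSocle

variable {A : Type u} [CommRing A]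

/-- Passing from a regular sequence to its powers multiplies the socle generator by the product
of the next lower powers. -/
theorem GeneratesSocleMod.mul_prod [IsLocalRing A] {I : Ideal A} {z : List A} (hz : RegularMod I z)
    (hzm : ∀ a ∈ z, a ∈ maximalIdeal A) {v : A} (hv : GeneratesSocleMod (I ⊔ Ideal.ofList z) v)
    (t : ℕ) : GeneratesSocleMod (I ⊔ Ideal.ofList (powList (t + 1) z))
      (v * (powList t z).prod) where
  mul_mem a ha := by
    rw [← mul_assoc]
    exact mul_prod_powList_mem_sup t (hv.mul_mem a ha)
  notMem h := hv.notMem (hz.mem_of_mul_prod_mem t h)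
  exists_sub_mem s hs := by
    obtain ⟨s', hs'⟩ := hz.exists_mul_prod_of_socle hzm t hs
    obtain ⟨r, hr⟩ := hv.exists_sub_mem s' fun a ha => hz.mem_of_mul_prod_mem t (by
      have : a * s' * (powList t z).prod = a * s - a * (s - s' * (powList t z).prod) := by ring
      rw [this]
      exact sub_mem (hs a ha) (Ideal.mul_mem_left _ _ hs'))
    refine ⟨r, ?_⟩
    have : s - r * (v * (powList t z).prod) =
      (s - s' * (powList t z).prod) + (s' - r * v) * (powList t z).prod := by ring
    rw [this]
    exact add_mem hs' (mul_prod_powList_mem_sup t hr)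

theorem ofList_powList_le_pow {z : List A} {n : Ideal A} (hz : ∀ a ∈ z, a ∈ n) (t : ℕ) :
    Ideal.ofList (powList t z) ≤ n ^ t := by
  rw [Ideal.ofList, Ideal.span_le]
  intro x hx
  obtain ⟨a, ha, rfl⟩ := List.mem_map.mp hx
  exact Ideal.pow_mem_pow (hz a ha) t

theorem ofList_le_radical_powList (z : List A) (t : ℕ) :
    Ideal.ofList z ≤ (Ideal.ofList (powList t z)).radical := by
  rw [Ideal.ofList, Ideal.span_le]
  intro a ha
  exact ⟨t, Ideal.subset_span (List.mem_map.mpr ⟨a, ha, rfl⟩)⟩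

theorem prod_powList_pow (z : List A) (t q : ℕ) :
    (powList t z).prod ^ q = (powList t (powList q z)).prod := by
  induction z with
  | nil => simp
  | cons a z ih =>
    simp only [List.map_cons, List.prod_cons] at ih ⊢
    rw [mul_pow, ih, ← pow_mul, ← pow_mul, mul_comm t q]

end RegularSocle

end

open scoped TensorProduct

/-! ### Rings of q-th roots: finiteness, splittings and the nonvanishing test. -/

section RootRing

instance (R : Type u) [CommRing R] [IsLocalRing R] (p e : ℕ) : IsLocalRing (RootRing R p e) :=
  inferInstanceAs (IsLocalRing R)

/-- The homomorphism `R^{1/q} → S^{1/q}` induced by `R → S`. -/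
instance (R : Type u) (S : Type v) [CommRing R] [CommRing S] [Algebra R S] (p e : ℕ) :
    Algebra (RootRing R p e) (RootRing S p e) :=
  inferInstanceAs (Algebra R S)

theorem FFinite.finite_rootRing {p : ℕ} [Fact p.Prime] {S : Type v} [CommRing S] [CharP S p]
    (hS : FFinite p S) (e : ℕ) : Module.Finite S (RootRing S p e) := by
  have h1 : (iterateFrobenius S p 1).Finite := hS
  change (iterateFrobenius S p e).Finite
  induction e with
  | zero =>
    have : iterateFrobenius S p 0 = RingHom.id S := by ext; simp
    rw [this]
    exact RingHom.Finite.id S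
  | succ e ih =>
    have : iterateFrobenius S p (e + 1) =
        (iterateFrobenius S p 1).comp (iterateFrobenius S p e) := by
      ext x
      rw [RingHom.comp_apply, iterateFrobenius_def, iterateFrobenius_def, iterateFrobenius_def,
        pow_one, pow_succ, pow_mul]
    rw [this]
    exact h1.comp ih

variable (p e : ℕ) [Fact p.Prime]

theorem rootSplits_of_hom {S : Type v} [CommRing S] [CharP S p] {c : S} {J : Ideal S}
    (hJ : ∀ a ∈ J, a • (qthRoot p e c : RootRing S p e) = 0)
    (φ : RootRing S p e →ₗ[S] S ⧸ J) (hφ : φ (qthRoot p e c) = 1) : RootSplits p e c := by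
  let g : (S ⧸ J) →ₗ[S] Submodule.span S {(qthRoot p e c : RootRing S p e)} :=
    quotToSpan ⟨qthRoot p e c, Submodule.mem_span_singleton_self _⟩
      fun a ha => Subtype.ext (hJ a ha)
  refine ⟨g.comp φ, ?_⟩
  rintro ⟨x, hx⟩
  obtain ⟨r, rfl⟩ := Submodule.mem_span_singleton.mp hx
  ext
  simp [hφ, g]

theorem rootSplits_zero {S : Type v} [CommRing S] [CharP S p] : RootSplits p e (0 : S) := by
  refine ⟨0, ?_⟩
  rintro ⟨x, hx⟩
  have : x = 0 := by simpa using hx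
  exact Subtype.ext this.symm

variable {R : Type u} {S : Type v} [CommRing R] [CommRing S] [CharP R p] [CharP S p] [Algebra R S]
  [IsLocalRing R]

theorem qthRoot_tmul_mk_tmul_ne_zero {𝔟 𝔟' : Ideal S} (h𝔟 : ∀ b ∈ 𝔟, b ^ p ^ e ∈ 𝔟')
    [hf : Module.Flat R (S ⧸ 𝔟')] {ω : Type w} [AddCommGroup ω] [Module R ω] {u : ω} {d : R}
    (hd : (qthRoot p e d : RootRing R p e) ⊗ₜ[R] u ≠ 0) {c s : S}
    (hc : c * s ^ p ^ e ∉ (maximalIdeal R).map (algebraMap R S) ⊔ 𝔟') :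
    (qthRoot p e (algebraMap R S d * c) : RootRing S p e) ⊗ₜ[S]
      ((Ideal.Quotient.mk 𝔟 s) ⊗ₜ[R] u) ≠ 0 := by
  -- Under x ↦ x^(1/q), flatness of S/𝔟' over R becomes flatness of the corresponding quotient of
  -- S^(1/q) over R^(1/q).
  let 𝔟'' : Ideal (RootRing S p e) := 𝔟'
  have : Module.Flat (RootRing R p e) (RootRing S p e ⧸ 𝔟'') := hf
  exact tmul_mk_tmul_ne_zero (R := R) (R' := RootRing R p e) (S := S) (S' := RootRing S p e)
    (𝔟' := 𝔟'') (fun r => (map_pow (algebraMap R S) r (p ^ e)).symm) h𝔟 hd (c := qthRoot p e c) hc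

end RootRing

/-! ### The common splitting criterion. -/

section Main

variable (p e : ℕ) [Fact p.Prime] {R : Type u} {S : Type v} [CommRing R] [CommRing S] [CharP R p]
  [CharP S p] [Algebra R S] [IsLocalRing R] [IsLocalRing S] [IsNoetherianRing R]
  [IsNoetherianRing S] [IsLocalHom (algebraMap R S)] [Module.Flat R S]

/-- The common splitting criterion: `d` controls the splitting over `R` and `c` is tested against
the socle of the closed fiber. -/
theorem rootSplits_algebraMap_mul (hS : FFinite p S) {J : Ideal R} (hJm : J ≤ maximalIdeal R)
    {d : R} (hJ : ∀ a ∈ J, a • (qthRoot p e d : RootRing R p e) = 0) {c : S} {z : List S}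
    (hz : RegularMod ((maximalIdeal R).map (algebraMap R S)) z)
    (hzn : ∀ a ∈ z, a ∈ maximalIdeal S)
    (hzr : maximalIdeal S ≤ ((maximalIdeal R).map (algebraMap R S) ⊔ Ideal.ofList z).radical)
    {v : S} (hv : GeneratesSocleMod ((maximalIdeal R).map (algebraMap R S) ⊔ Ideal.ofList z) v)
    {E : Type u} [AddCommGroup E] [Module R E] [Module.Injective R E] {u : E}
    (hu : IsSocleGenerator R u)
    (hd : ∀ (N : Submodule R E) (huN : u ∈ N), (∀ a ∈ J, ∀ x ∈ N, a • x = 0) →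
      (qthRoot p e d : RootRing R p e) ⊗ₜ[R] (⟨u, huN⟩ : N) ≠ 0)
    (hc : c * v ^ p ^ e ∉
      (maximalIdeal R).map (algebraMap R S) ⊔ Ideal.ofList (powList (p ^ e) z)) :
    RootSplits p e (algebraMap R S d * c) := by
  have hfin := hS.finite_rootRing e
  have hJS : ∀ a ∈ J.map (algebraMap R S),
      a • (qthRoot p e (algebraMap R S d * c) : RootRing S p e) = 0 := by
    have hle : J.map (algebraMap R S) ≤ LinearMap.ker (LinearMap.toSpanSingleton S
        (RootRing S p e) (qthRoot p e (algebraMap R S d * c))) := by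
      rw [Ideal.map_le_iff_le_comap]
      intro a ha
      have h1 : a ^ p ^ e * d = 0 := hJ a ha
      have h2 : (algebraMap R S a) ^ p ^ e * (algebraMap R S d * c) = 0 := by
        rw [← mul_assoc, ← map_pow, ← map_mul, h1, map_zero, zero_mul]
      exact h2
    exact fun a ha => hle ha
  suffices h : ∃ φ : RootRing S p e →ₗ[S] S ⧸ J.map (algebraMap R S),
      φ (qthRoot p e (algebraMap R S d * c)) = 1 by
    obtain ⟨φ, hφ⟩ := h
    exact rootSplits_of_hom p e hJS φ hφ
  refine exists_hom_apply_eq_one _ _ fun k => ?_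
  -- The exponent k + 1 keeps IR inside m even for k = 0, so that u lies in its annihilator ω.
  set IR : Ideal R := J ⊔ maximalIdeal R ^ (k + 1) with hIR
  set 𝔟 : Ideal S := Ideal.ofList (powList (k + 1) z) with h𝔟
  have hIRm : IR ≤ maximalIdeal R :=
    sup_le hJm (Ideal.pow_le_self (Nat.succ_ne_zero k))
  have hflat : Module.Flat R (S ⧸ 𝔟) := (hz.powList (k + 1)).flat_quotient_ofList
  have hrad : maximalIdeal S ≤ (IR.map (algebraMap R S) ⊔ 𝔟).radical := by
    refine hzr.trans (Ideal.radical_le_radical_iff.mpr (sup_le ?_ ?_))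
    · rw [Ideal.map_le_iff_le_comap]
      intro a ha
      refine ⟨k + 1, Ideal.mem_sup_left ?_⟩
      rw [← map_pow]
      exact Ideal.mem_map_of_mem _ (Ideal.mem_sup_right (Ideal.pow_mem_pow ha _))
    · exact (ofList_le_radical_powList z (k + 1)).trans (Ideal.radical_mono le_sup_right)
  obtain ⟨M, hM⟩ := Ideal.exists_pow_le_of_le_radical_of_fg hrad (IsNoetherian.noetherian _)
  have hlenR : Module.length R (R ⧸ IR) ≠ ⊤ :=
    length_quotient_ne_top_of_pow_le (k := k + 1) le_sup_right
  have hlenS := length_quotient_ne_top_of_pow_le hM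
  let ω := Submodule.torsionBySet R E IR
  have huω : u ∈ ω := (Submodule.mem_torsionBySet_iff _ _).mpr fun a =>
    hu.smul_eq_zero a (hIRm a.2)
  have hω : ∀ a ∈ IR, ∀ x ∈ ω, a • x = 0 := fun a ha x hx =>
    (Submodule.mem_torsionBySet_iff _ _).mp hx ⟨a, ha⟩
  have huω' : IsSocleGenerator R (⟨u, huω⟩ : ω) := hu.torsionBySet huω
  have hw := hv.mul_prod hz hzn k
  have hsoc := huω'.mk_tmul hw
  have hann : ∀ a ∈ IR.map (algebraMap R S) ⊔ 𝔟, ∀ y : (S ⧸ 𝔟) ⊗[R] ω, a • y = 0 := by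
    have hle : IR.map (algebraMap R S) ⊔ 𝔟 ≤ Module.annihilator S ((S ⧸ 𝔟) ⊗[R] ω) := by
      refine sup_le (Ideal.map_le_iff_le_comap.mpr fun a ha => ?_) fun a ha => ?_
      · rw [Ideal.mem_comap, Module.mem_annihilator]
        intro y
        rw [algebraMap_smul]
        induction y with
        | zero => rw [smul_zero]
        | add x y hx hy => rw [smul_add, hx, hy, add_zero]
        | tmul s x =>
          have : a • x = 0 := Subtype.ext (hω a ha x x.2)
          rw [← TensorProduct.tmul_smul, this, TensorProduct.tmul_zero]
      · rw [Module.mem_annihilator]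
        intro y
        induction y with
        | zero => rw [smul_zero]
        | add x y hx hy => rw [smul_add, hx, hy, add_zero]
        | tmul s x =>
          obtain ⟨s, rfl⟩ := Ideal.Quotient.mk_surjective s
          have : a • Ideal.Quotient.mk 𝔟 s = 0 :=
            Ideal.Quotient.eq_zero_iff_mem.mpr (𝔟.mul_mem_right s ha)
          rw [TensorProduct.smul_tmul', this, TensorProduct.zero_tmul]
    exact fun a ha y => Module.mem_annihilator.mp (hle ha) y
  refine ⟨IR.map (algebraMap R S) ⊔ 𝔟, ?_, hlenS, (S ⧸ 𝔟) ⊗[R] ω, inferInstance, inferInstance,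
    _, hsoc, hann, ?_, fun y hy => ?_⟩
  · rw [hIR, Ideal.map_sup, Ideal.map_pow, sup_assoc]
    refine sup_le_sup_left (sup_le ?_ ?_) _
    · exact (Ideal.pow_right_mono map_maximalIdeal_le _).trans (Ideal.pow_le_pow_right k.le_succ)
    · exact (ofList_powList_le_pow hzn _).trans (Ideal.pow_le_pow_right k.le_succ)
  -- By flatness the lengths of S/𝔟 ⊗ R/IR and S/𝔟 ⊗ ω are those of R/IR and ω times a common
  -- factor, and R/IR and ω are equally long.
  · refine (length_quotient_sup_le 𝔟 IR).trans ?_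
    have hωlen : Module.length R ω = Module.length R (R ⧸ IR) := hu.length_torsionBySet hlenR
    have hωfin : IsFiniteLength R ω := Module.length_ne_top_iff.mp (by rw [hωlen]; exact hlenR)
    rw [length_tensor (Module.length_ne_top_iff.mp hlenR), length_tensor hωfin, hωlen]
  · have hzq := hz.powList (p ^ e)
    have hflat' : Module.Flat R (S ⧸ Ideal.ofList (powList (k + 1) (powList (p ^ e) z))) :=
      (hzq.powList (k + 1)).flat_quotient_ofList
    refine hsoc.eq_zero_of_tmul_eq_zero (fun a ha y => hann a (hM ha) y)
      (qthRoot_tmul_mk_tmul_ne_zero p e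
        (𝔟' := Ideal.ofList (powList (k + 1) (powList (p ^ e) z))) ?_
        (hd ω huω fun a ha => hω a (Ideal.mem_sup_left ha)) ?_) hy
    · have hle : 𝔟 ≤ (Ideal.ofList (powList (k + 1) (powList (p ^ e) z))).comap
          (iterateFrobenius S p e) := by
        rw [h𝔟, Ideal.ofList, Ideal.span_le]
        intro x hx
        obtain ⟨a, ha, rfl⟩ := List.mem_map.mp hx
        refine Ideal.subset_span ?_
        simp only [Set.mem_ofPred_eq, List.mem_map, iterateFrobenius_def]
        exact ⟨a ^ p ^ e, ⟨a, ha, rfl⟩, by ring⟩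
      exact fun b hb => hle hb
    -- The q-th power of v (∏ z)^k is v^q times the k-th powers of the z^q, which the colon formula
    -- for the sequence z^q removes.
    · intro hmem
      rw [mul_pow, prod_powList_pow, ← mul_assoc] at hmem
      exact hc (hzq.mem_of_mul_prod_mem k hmem)

end Main

/-! ### Lifting parameters and socle from the Gorenstein closed fiber. -/

section GorensteinFiber

theorem generatesSocleMod_of_finrank_eq_one {A : Type u} [CommRing A] [IsLocalRing A] {I : Ideal A}
    (h : Module.finrank (A ⧸ maximalIdeal A) (socle I) = 1) : ∃ v : A, GeneratesSocleMod I v := by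
  let _ := Ideal.Quotient.field (maximalIdeal A)
  obtain ⟨⟨x, hx⟩, hne, hspan⟩ := finrank_eq_one_iff'.mp h
  obtain ⟨v, rfl⟩ := Ideal.Quotient.mk_surjective x
  have hmem : ∀ s : A, Ideal.Quotient.mk I s ∈ socle I ↔ ∀ a ∈ maximalIdeal A, a * s ∈ I := by
    intro s
    rw [Submodule.mem_torsionBySet_iff]
    constructor
    · intro hs a ha
      have := hs ⟨a, ha⟩
      rw [← Ideal.Quotient.eq_zero_iff_mem, map_mul]
      exact this
    · rintro hs ⟨a, ha⟩
      have := hs a ha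
      rw [← Ideal.Quotient.eq_zero_iff_mem, map_mul] at this
      exact this
  refine ⟨v, (hmem v).mp hx, fun hv => hne (Subtype.ext (Ideal.Quotient.eq_zero_iff_mem.mpr hv)),
    fun s hs => ?_⟩
  obtain ⟨r, hr⟩ := hspan ⟨Ideal.Quotient.mk I s, (hmem s).mpr hs⟩
  obtain ⟨r, rfl⟩ := Ideal.Quotient.mk_surjective r
  refine ⟨r, ?_⟩
  rw [← Ideal.Quotient.eq, map_mul]
  exact (congrArg Subtype.val hr).symm

theorem GeneratesSocleMod.comap_mk {A : Type u} [CommRing A] [IsLocalRing A] {K : Ideal A}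
    [IsLocalRing (A ⧸ K)] {I : Ideal (A ⧸ K)} {v : A}
    (hv : GeneratesSocleMod I (Ideal.Quotient.mk K v)) :
    GeneratesSocleMod (I.comap (Ideal.Quotient.mk K)) v := by
  have hm : ∀ a : A, Ideal.Quotient.mk K a ∈ maximalIdeal (A ⧸ K) ↔ a ∈ maximalIdeal A := by
    have := ((IsLocalRing.local_hom_TFAE (Ideal.Quotient.mk K)).out 0 4).mp
      (IsLocalHom.of_surjective _ Ideal.Quotient.mk_surjective)
    intro a
    rw [← Ideal.mem_comap, this]
  refine ⟨fun a ha => ?_, hv.notMem, fun s hs => ?_⟩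
  · rw [Ideal.mem_comap, map_mul]
    exact hv.mul_mem _ ((hm a).mpr ha)
  · obtain ⟨r, hr⟩ := hv.exists_sub_mem (Ideal.Quotient.mk K s) fun a ha => by
      obtain ⟨a, rfl⟩ := Ideal.Quotient.mk_surjective a
      rw [← map_mul]
      exact hs a ((hm a).mp ha)
    obtain ⟨r, rfl⟩ := Ideal.Quotient.mk_surjective r
    exact ⟨r, by simpa using hr⟩

theorem comap_mk_ofList_map {A : Type u} [CommRing A] (K : Ideal A) (z : List A) :
    (Ideal.ofList (z.map (Ideal.Quotient.mk K))).comap (Ideal.Quotient.mk K) =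
      K ⊔ Ideal.ofList z := by
  rw [← Ideal.map_ofList, Ideal.comap_map_of_surjective _ Ideal.Quotient.mk_surjective,
    ← RingHom.ker_eq_comap_bot, Ideal.mk_ker, sup_comm]

theorem ofList_powList_le_frobPower {A : Type u} [CommRing A] (z : List A) (q : ℕ) :
    Ideal.ofList (powList q z) ≤ frobPower (Ideal.ofList z) q := by
  rw [Ideal.ofList, Ideal.span_le]
  intro x hx
  obtain ⟨a, ha, rfl⟩ := List.mem_map.mp hx
  exact Ideal.subset_span ⟨a, Ideal.subset_span ha, rfl⟩

theorem powList_map {A : Type u} {B : Type v} [CommRing A] [CommRing B] (f : A →+* B)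
    (z : List A) (q : ℕ) : powList q (z.map f) = (powList q z).map f := by
  simp [powList]

theorem notMem_of_mk_notMem_frobPower {A : Type u} [CommRing A] {K : Ideal A} {z : List A}
    {q : ℕ} {x : A}
    (h : Ideal.Quotient.mk K x ∉ frobPower (Ideal.ofList (z.map (Ideal.Quotient.mk K))) q) :
    x ∉ K ⊔ Ideal.ofList (powList q z) := by
  rw [← comap_mk_ofList_map, Ideal.mem_comap, ← powList_map]
  exact fun hx => h (ofList_powList_le_frobPower _ _ hx)

/-- A system of parameters of a Gorenstein quotient and its socle, lifted to `A`. -/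
theorem IsGorensteinLocal.exists_lift {A : Type u} [CommRing A] [IsLocalRing A] {K : Ideal A}
    [IsLocalRing (A ⧸ K)] (h : IsGorensteinLocal (A ⧸ K)) :
    ∃ (z : List A) (v : A), IsSOP (z.map (Ideal.Quotient.mk K)) ∧ RegularMod K z ∧
      (∀ a ∈ z, a ∈ maximalIdeal A) ∧ maximalIdeal A ≤ (K ⊔ Ideal.ofList z).radical ∧
      GeneratesSocleMod (K ⊔ Ideal.ofList z) v ∧
      Ideal.Quotient.mk K v ∉ Ideal.ofList (z.map (Ideal.Quotient.mk K)) := by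
  obtain ⟨-, z', hsop, hreg, hrank⟩ := h
  obtain ⟨z, rfl⟩ := (List.map_surjective_iff.mpr
    (Ideal.Quotient.mk_surjective (I := K))) z'
  obtain ⟨v', hv⟩ := generatesSocleMod_of_finrank_eq_one hrank
  obtain ⟨v, rfl⟩ := Ideal.Quotient.mk_surjective v'
  have hrad : (K ⊔ Ideal.ofList z).radical = maximalIdeal A := by
    rw [← comap_mk_ofList_map, ← Ideal.comap_radical, hsop.2]
    exact ((IsLocalRing.local_hom_TFAE (Ideal.Quotient.mk K)).out 0 4).mp
      (IsLocalHom.of_surjective _ Ideal.Quotient.mk_surjective)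
  refine ⟨z, v, hsop, ?_, fun a ha => ?_, hrad.ge, ?_, hv.notMem⟩
  · have := (regularMod_of_isWeaklyRegular hreg.toIsWeaklyRegular).comap_mk
    rwa [← RingHom.ker_eq_comap_bot, Ideal.mk_ker] at this
  · rw [← hrad]
    exact Ideal.le_radical (Ideal.mem_sup_right (Ideal.subset_span ha))
  · rw [← comap_mk_ofList_map]
    exact hv.comap_mk

end GorensteinFiber

/-! ### Nonvanishing over R, from a splitting or from Frobenius closedness. -/

section RetractionTensor

variable (p e : ℕ) [Fact p.Prime] {R : Type u} [CommRing R] [CharP R p]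

/-- A retraction onto `R d^{1/q}` detects elements killed by the annihilator of `d^{1/q}`. -/
theorem RootSplits.tmul_ne_zero {d : R} (hd : RootSplits p e d) {N : Type w} [AddCommGroup N]
    [Module R N] {u : N} (hu : u ≠ 0)
    (hN : ∀ a ∈ Ideal.torsionOf R (RootRing R p e) (qthRoot p e d), ∀ x : N, a • x = 0) :
    (qthRoot p e d : RootRing R p e) ⊗ₜ[R] u ≠ 0 := by
  obtain ⟨ρ, hρ⟩ := hd
  let x : RootRing R p e := qthRoot p e d
  let equiv := Ideal.quotTorsionOfEquivSpanSingleton R (RootRing R p e) x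
  let g : RootRing R p e →ₗ[R] N →ₗ[R] N :=
    (quotToSpan (LinearMap.id : N →ₗ[R] N)
      (fun a ha => LinearMap.ext fun y => hN a ha y)).comp (equiv.symm.toLinearMap.comp ρ)
  have hx : g x = LinearMap.id := by
    have h1 : ρ x = ⟨x, Submodule.mem_span_singleton_self x⟩ :=
      hρ ⟨x, Submodule.mem_span_singleton_self x⟩
    have h2 : equiv.symm ⟨x, Submodule.mem_span_singleton_self x⟩ = 1 := by
      rw [LinearEquiv.symm_apply_eq]
      ext
      exact (one_smul R x).symm
    simp only [g, LinearMap.comp_apply, LinearEquiv.coe_coe, h1, h2, quotToSpan_one]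
  intro h0
  have := congrArg (TensorProduct.lift g) h0
  rw [TensorProduct.lift.tmul, map_zero] at this
  exact hu (by rw [← LinearMap.id_apply (R := R) u, ← hx]; exact this)

theorem ZeroFrobClosed.tmul_ne_zero {E : Type w} [AddCommGroup E] [Module R E]
    (hE : ZeroFrobClosed p R E) {u : E} (hu : u ≠ 0) (N : Submodule R E) (huN : u ∈ N) :
    (1 : RootRing R p e) ⊗ₜ[R] (⟨u, huN⟩ : N) ≠ 0 := by
  intro h0
  have := congrArg (N.subtype.lTensor (RootRing R p e)) h0
  rw [LinearMap.lTensor_tmul, map_zero] at this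
  exact hu (hE e u this)

end RetractionTensor

theorem IsInjectiveHull.exists_isSocleGenerator {R : Type u} [CommRing R] [IsLocalRing R]
    {E : Type u} [AddCommGroup E] [Module R E] (h : IsInjectiveHull R (ResidueField R) E) :
    ∃ u : E, IsSocleGenerator R u := by
  obtain ⟨-, i, hi, hess⟩ := h
  have hres : ∀ x : ResidueField R, ∃ r : R, x = r • (1 : ResidueField R) := fun x => by
    obtain ⟨r, rfl⟩ := IsLocalRing.residue_surjective x
    exact ⟨r, by rw [Algebra.smul_def, mul_one]; rfl⟩
  refine ⟨i 1, fun a ha => ?_, ?_, fun x hx => ?_⟩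
  · have : a • (1 : ResidueField R) = 0 := by
      rw [Algebra.smul_def, mul_one]
      exact (IsLocalRing.residue_eq_zero_iff a).mpr ha
    rw [← map_smul, this, map_zero]
  · rw [Ne, map_eq_zero_iff i hi]
    exact one_ne_zero
  · by_cases hx0 : x = 0
    · exact ⟨0, by rw [hx0, zero_smul]⟩
    obtain ⟨y, hy, hy0⟩ := Submodule.exists_mem_ne_zero_of_ne_bot
      (hess (R ∙ x) (by rwa [Ne, Submodule.span_singleton_eq_bot]))
    obtain ⟨hyx, k, hk⟩ := hy
    obtain ⟨r, rfl⟩ := Submodule.mem_span_singleton.mp hyx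
    have hru : IsUnit r := by
      by_contra h
      exact hy0 (hx r (by simpa using h))
    obtain ⟨r, rfl⟩ := hru
    obtain ⟨s, rfl⟩ := hres k
    refine ⟨((r⁻¹ : Rˣ) : R) * s, ?_⟩
    rw [mul_smul, ← map_smul, hk, smul_smul]
    simp

end FSplit

/-! ### The proposition. -/

open FSplit in
theorem proposition3p3 (p : ℕ) [Fact p.Prime]
    (R : Type u) [CommRing R] [IsLocalRing R] [IsNoetherianRing R] [CharP R p] [IsReduced R]
    (S : Type v) [CommRing S] [IsLocalRing S] [IsNoetherianRing S] [CharP S p] [IsReduced S]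
    [Algebra R S] [IsLocalHom (algebraMap R S)] [Module.Flat R S]
    (hR : FFinite p R) (hS : FFinite p S)
    (hG : IsGorensteinLocal (ClosedFiber R S)) :
    (∀ c : R, (∃ e ≥ 1, RootSplits p e c) → FInjective p (ClosedFiber R S) →
      ∃ e ≥ 1, RootSplits p e (algebraMap R S c)) ∧
    (∀ (E : Type u) [AddCommGroup E] [Module R E],
      IsInjectiveHull R (IsLocalRing.ResidueField R) E → ZeroFrobClosed p R E →
      FRational p (ClosedFiber R S) →
      ∀ c : S, c ∉ (IsLocalRing.maximalIdeal R).map (algebraMap R S) →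
        ∃ e ≥ 1, RootSplits p e c) := by
  have hN : IsNoetherianRing (ClosedFiber R S) := hG.1
  obtain ⟨z, v, hsop, hz, hzn, hzr, hv, hvz⟩ := hG.exists_lift
  have hpar : IsParameterIdeal (Ideal.ofList
      (z.map (Ideal.Quotient.mk ((maximalIdeal R).map (algebraMap R S))))) :=
    ⟨_, [], by rwa [List.append_nil], rfl⟩
  constructor
  · rintro c ⟨e, he, hc⟩ hFI
    refine ⟨e, he, ?_⟩
    -- For c = 0 the annihilator of c^(1/q) is all of R, and the criterion needs it inside m.
    by_cases hc0 : c = 0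
    · rw [hc0, map_zero]
      exact rootSplits_zero p e
    obtain ⟨E, _, _, u, hE, hu⟩ := exists_injective_isSocleGenerator R
    have hJm : Ideal.torsionOf R (RootRing R p e) (qthRoot p e c) ≤ maximalIdeal R := by
      refine IsLocalRing.le_maximalIdeal fun h => hc0 ?_
      have h1 : (1 : R) ∈ Ideal.torsionOf R (RootRing R p e) (qthRoot p e c) := h ▸ trivial
      rw [Ideal.mem_torsionOf_iff, one_smul] at h1
      exact h1
    have := rootSplits_algebraMap_mul p e hS hJm (d := c) (c := 1)
      (fun a ha => (Ideal.mem_torsionOf_iff _ _).mp ha) hz hzn hzr hv hu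
      (fun N huN hJN => hc.tmul_ne_zero p e (fun h => hu.ne_zero (congrArg Subtype.val h))
        fun a ha x => Subtype.ext (hJN a ha x x.2))
      (notMem_of_mk_notMem_frobPower fun h => hvz (hFI _ hpar _ e (by simpa using h)))
    rwa [mul_one] at this
  · intro E _ _ hE hzero hFR c hc
    obtain ⟨u, hu⟩ := hE.exists_isSocleGenerator
    have := hE.1
    have hc0 : Ideal.Quotient.mk ((maximalIdeal R).map (algebraMap R S)) c ≠ 0 := fun h =>
      hc (Ideal.Quotient.eq_zero_iff_mem.mp h)
    have hnot := mt (hFR _ hpar _) hvz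
    simp only [InTightClosure, not_exists, not_and, not_forall] at hnot
    -- Failure of the tight closure condition with threshold 1 yields an exponent e ≥ 1.
    obtain ⟨e, he, hmem⟩ := hnot _ (hFR.notMem_minimalPrimes hc0) 1
    refine ⟨e, he, ?_⟩
    have := rootSplits_algebraMap_mul p e hS (J := ⊥) bot_le (d := 1) (c := c)
      (fun a ha => by rw [(Submodule.mem_bot R).mp ha, zero_smul]) hz hzn hzr hv hu
      (fun N huN _ => by
        rw [map_one]
        exact hzero.tmul_ne_zero p e hu.ne_zero N huN)
      (notMem_of_mk_notMem_frobPower (by rwa [map_mul, map_pow]))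
    rwa [map_one, one_mul] at this
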